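/- **Setting.** Let $P=\{x\in\mathbb R^n: l_r(x)=\langle x,\nu_r\rangle+\lambda_r\ge 0,\ r=1,\dots,d\}$ be a Delzant polytope with primitive inward facet normals $\nu_r$, let $(M,\omega)$ be the associated symplectic toric manifold with moment map $\mu$ and action-angle coordinates $(x,\theta)$ on $\mathring M=\mu^{-1}(\mathring P)$, and let $g$ be a symplectic potential: $g=\frac12\sum_r l_r\log l_r+h$ on $\mathring P$ with $h\in C^\infty(P)$, its Hessian is positive definite on $\mathring P$, and the determinant of the Hessian is $(\delta\prod_r l_r)^{-1}$ with $\delta$ smooth and strictly positive on $P$. Let $p<n$, $B\in SL(n,\mathbb Z)$, $\tilde x=Bx$, $\tilde\theta={}^tB^{-1}\theta$, $H=\frac12\sum_{j=1}^p\tilde x_j^2$ and $g_s=g+sH$, $s\ge0$. Let $\tilde G_s$ be the Hessian of $g_s$ in the coordinates $\tilde x$, let $\tilde G=\tilde G_0$, and let $D$ be its lower right $(n-p)\times(n-p)$ diagonal block. For a vertex $v$ of $P$ let $A_v$ be the matrix whose rows are the normals of the facets adjacent to $v$ and $\lambda_v$ the vector of the corresponding $\lambda_r$; put $\tilde A_v=A_vB^{-1}$.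 On the vertex chart $U_v\subset M$ (the points whose image under $\mu$ is on no facet except those adjacent to $v$) let $\tilde x_v=\tilde A_v\tilde x+\lambda_v$ and $\tilde\theta_v={}^t\tilde A_v^{-1}\tilde\theta$, so that $\sqrt{2\tilde x_v^j}\,e^{i\tilde\theta_v^j}$, $j=1,\dots,n$, are smooth complex valued coordinates on $U_v$. Each potential $g_s$ gives holomorphic coordinates $\tilde w_{v}^j=\exp(\partial g_s/\partial\tilde x_v^j+i\tilde\theta_v^j)$ on $U_v$ (extended continuously from $\mathring M \cap U_v$), hence a Kähler polarization $\mathcal P_s$, the holomorphic tangent space $\bigcap_j\ker d\overline{\tilde w_v^j}$. Let $\tilde G^v_s$ be the Hessian of $g_s$ in the coordinates $\tilde x_v$. At boundary points of $P$, $\tilde G_s^{-1}$, $(\tilde G_s^v)^{-1}$ and $D^{-1}$ denote the values of the continuous extensions from $\mathring P$. For a face $F$ of $P$ (possibly $P$ itself) write $j\in F$ if $\tilde w_v^j=0$ along $\mu^{-1}(F)\cap U_v$. **Proposition.** At every point of $U_v$ whose image under $\mu$ lies in the relative interior of $F$, the continuous extensions just mentioned exist, $((\tilde G_s^v)^{-1})_{jk}=0$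 for all $k\in F$ and all $j$, and for every $s\ge0$ $$\mathcal P_s=\Big\langle\frac{\partial}{\partial\tilde w_v^j},\ j\in F\Big\rangle_{\mathbb C}\oplus\Big\langle\sum_{k\notin F}(\tilde G_s^v)^{-1}_{jk}\frac{\partial}{\partial\tilde x_v^k}-i\frac{\partial}{\partial\tilde\theta_v^j},\ j\notin F\Big\rangle_{\mathbb C},$$ where $\partial/\partial\tilde w_v^j$ may be taken with respect to the holomorphic coordinates of any of the potentials $g_t$, $t\ge0$. Moreover $$\tilde G_\infty^{-1}:=\lim_{s\to+\infty}\tilde G_s^{-1}=\begin{bmatrix}0&0\\0&D^{-1}\end{bmatrix},$$ and the limit $\mathcal P_\infty=\lim_{s\to+\infty}\mathcal P_s$ exists in the Grassmannian of complex $n$-dimensional subspaces of the complexified tangent space and is $$\mathcal P_\infty=\Big\langle\frac{\partial}{\partial\tilde w_v^j},\ j\in F\Big\rangle_{\mathbb C}\oplus\Big\langle\sum_{k\notin F}\sum_{q,r=1}^n(\tilde A_v)_{jq}(\tilde G_\infty^{-1})_{qr}(\tilde A_v^T)_{rk}\frac{\partial}{\partial\tilde x_v^k}-i\frac{\partial}{\partial\tilde\theta_v^j},\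 j\notin F\Big\rangle_{\mathbb C}$$ $$=\Big\langle\frac{\partial}{\partial\tilde w_v^j},\ j\in F\Big\rangle_{\mathbb C}\oplus\Big\langle\sum_{q,l=p+1}^n(\tilde A_v)_{jq}D^{-1}_{(q-p)(l-p)}\frac{\partial}{\partial\tilde x^l}-i\frac{\partial}{\partial\tilde\theta_v^j},\ j\notin F\Big\rangle_{\mathbb C}.$$ Here $\partial/\partial\tilde x^l=\sum_{k\notin F}(\tilde A_v)_{kl}\,\partial/\partial\tilde x_v^k$ along $F$; the vectors above are tangent to the face, i.e. $(\tilde A_v\tilde G_\infty^{-1}\tilde A_v^T)_{jk}=0$ for all $k\in F$ and all $j$. -/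

import Mathlib

open Filter Topology Matrix
open scoped ContDiff

noncomputable section

/-- A Delzant polytope in `ℝⁿ` with `d` facets,
`P = {x | ⟨x, ν_r⟩ + lam_r ≥ 0, r = 1, …, d}`: compact, with nonempty interior, with primitive
integral inward normals `ν_r`, with one inequality for each facet, and such that at each vertex
exactly `n` facets meet, their normals forming a basis of the lattice `ℤⁿ`. -/
structure DelzantPolytope (n d : ℕ) where
  /-- inward pointing primitive normals -/
  ν : Fin d → Fin n → ℤ
  /-- the constants of the inequalities -/
  lam : Fin d → ℝ
  compact : IsCompact {x : Fin n → ℝ | ∀ r, 0 ≤ (∑ k, x k * (ν r k : ℝ)) + lam r}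
  interior_nonempty :
    (interior {x : Fin n → ℝ | ∀ r, 0 ≤ (∑ k, x k * (ν r k : ℝ)) + lam r}).Nonempty
  primitive : ∀ r, ∀ m : ℤ, (∀ k, m ∣ ν r k) → IsUnit m
  facet : ∀ r, ∃ x : Fin n → ℝ, (∑ k, x k * (ν r k : ℝ)) + lam r = 0 ∧
    ∀ r', r' ≠ r → 0 < (∑ k, x k * (ν r' k : ℝ)) + lam r'
  vertex : ∀ v ∈ Set.extremePoints ℝ
      {x : Fin n → ℝ | ∀ r, 0 ≤ (∑ k, x k * (ν r k : ℝ)) + lam r},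
    ∃ σ : Fin n → Fin d, Function.Injective σ ∧
      (∀ r, (∑ k, v k * (ν r k : ℝ)) + lam r = 0 ↔ r ∈ Set.range σ) ∧
      IsUnit (Matrix.of fun j k => ν (σ j) k).det

/-- Hessian of `f` at `x` with respect to the affine coordinates `y` whose coordinate vector
fields `∂/∂y_i` are the (constant) columns of `C`: the matrix `∂²f/∂y_i∂y_j`. -/
def hessianIn {n : ℕ} (C : Matrix (Fin n) (Fin n) ℝ) (f : (Fin n → ℝ) → ℝ) (x : Fin n → ℝ) :
    Matrix (Fin n) (Fin n) ℝ :=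
  Matrix.of fun i j =>
    fderiv ℝ (fun y => fderiv ℝ f y (C *ᵥ Pi.single i 1)) x (C *ᵥ Pi.single j 1)

namespace DelzantPolytope

variable {n d : ℕ} (P : DelzantPolytope n d)

/-- The affine function `l_r(x) = ⟨x, ν_r⟩ + lam_r`. -/
def l (r : Fin d) (x : Fin n → ℝ) : ℝ := (∑ k, x k * (P.ν r k : ℝ)) + P.lam r

/-- The polytope as a set. -/
def carrier : Set (Fin n → ℝ) := {x | ∀ r, 0 ≤ P.l r x}

/-- Guillemin's potential `g_P = ½ ∑ l_r log l_r`. -/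
def guillemin (x : Fin n → ℝ) : ℝ := (1 / 2) * ∑ r, P.l r x * Real.log (P.l r x)

/-- Symplectic potentials: on the interior of `P`, `g = g_P + h` with `h ∈ C^∞(P)`, the Hessian `G`
of `g` is positive definite there, and `det G = (δ ∏ l_r)⁻¹` with `δ` smooth and strictly positive
on all of `P`. -/
def IsSymplecticPotential (g : (Fin n → ℝ) → ℝ) : Prop :=
  (∃ h : (Fin n → ℝ) → ℝ, ContDiffOn ℝ ∞ h P.carrier ∧
    ∀ x ∈ interior P.carrier, g x = P.guillemin x + h x) ∧
  (∀ x ∈ interior P.carrier, (hessianIn 1 g x).PosDef) ∧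
  ∃ δ : (Fin n → ℝ) → ℝ, ContDiffOn ℝ ∞ δ P.carrier ∧ (∀ x ∈ P.carrier, 0 < δ x) ∧
    ∀ x ∈ interior P.carrier, (hessianIn 1 g x).det = (δ x * ∏ r, P.l r x)⁻¹

/-- Boundary values: the value at `x₀ ∈ P` of the continuous extension to `P` of a function given
on the interior of `P`. -/
def bdryValue {Y : Type*} [TopologicalSpace Y] (f : (Fin n → ℝ) → Y) (x₀ : Fin n → ℝ) : Y :=
  extendFrom (interior P.carrier) f x₀

/-- A vertex `v` of `P`, together with an enumeration of the facets adjacent to it. -/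
structure VertexChart where
  v : Fin n → ℝ
  isVertex : v ∈ Set.extremePoints ℝ P.carrier
  facetAt : Fin n → Fin d
  injective : Function.Injective facetAt
  active : ∀ r, P.l r v = 0 ↔ r ∈ Set.range facetAt

end DelzantPolytope

/-- The complexified tangent space of `ℂⁿ = {(u_j + i v_j)_j}` at any point: the pair `(a, b)` is
`∑_j a_j ∂/∂u_j + b_j ∂/∂v_j`, with complex `a_j, b_j`. -/
abbrev TangentC (n : ℕ) : Type := (Fin n → ℂ) × (Fin n → ℂ)

/-- The complex linear extension to the complexified tangent space of the real differential at `ξ`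
of a complex valued function on `ℂⁿ`. -/
def differentialC {n : ℕ} (f : (Fin n → ℂ) → ℂ) (ξ : Fin n → ℂ) : TangentC n →ₗ[ℂ] ℂ where
  toFun V := ∑ j, (V.1 j * fderiv ℝ f ξ (Pi.single j 1) +
    V.2 j * fderiv ℝ f ξ (Pi.single j Complex.I))
  map_add' V W := by
    rw [← Finset.sum_add_distrib]
    refine Finset.sum_congr rfl fun j _ => ?_
    simp only [Prod.fst_add, Prod.snd_add, Pi.add_apply]
    ring
  map_smul' a V := by
    rw [RingHom.id_apply, smul_eq_mul, Finset.mul_sum]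
    refine Finset.sum_congr rfl fun j _ => ?_
    simp only [Prod.smul_fst, Prod.smul_snd, Pi.smul_apply, smul_eq_mul]
    ring

/-- Convergence, as `s → +∞`, of `k`-dimensional subspaces in the complex Grassmannian: the
subspaces have (for large `s`) frames converging to a frame of the limit subspace. -/
def TendstoGrassmannian {E : Type*} [AddCommGroup E] [Module ℂ E] [TopologicalSpace E] (k : ℕ)
    (L : ℝ → Submodule ℂ E) (L₀ : Submodule ℂ E) : Prop :=
  ∃ (b : ℝ → Fin k → E) (b₀ : Fin k → E),
    (∀ᶠ s in atTop, LinearIndependent ℂ (b s) ∧ Submodule.span ℂ (Set.range (b s)) = L s) ∧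
    LinearIndependent ℂ b₀ ∧ Submodule.span ℂ (Set.range b₀) = L₀ ∧
    Tendsto b atTop (𝓝 b₀)

namespace DelzantPolytope.VertexChart

variable {n d : ℕ} {P : DelzantPolytope n d} (c : P.VertexChart)

/-- `A_v`: its rows are the normals of the facets adjacent to `v`. -/
def A : Matrix (Fin n) (Fin n) ℝ := Matrix.of fun j k => (P.ν (c.facetAt j) k : ℝ)

/-- The moment map in the vertex chart. The chart is given by the smooth coordinates
`ξ_j = u_j + i v_j = √(2 x_v^j) e^{i θ_v^j}`, so that `x_v^j = |ξ_j|² / 2`, the symplectic form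
`∑ dx_v^j ∧ dθ_v^j` is `∑ du_j ∧ dv_j`, and `μ = x` where `x_v = A_v x + λ_v`. -/
def moment (ξ : Fin n → ℂ) : Fin n → ℝ :=
  c.A⁻¹ *ᵥ fun j => ‖ξ j‖ ^ 2 / 2 - P.lam (c.facetAt j)

/-- The coordinate neighbourhood `U_v` of the fixed point over `v`: the open part of the toric
manifold lying over the points of `P` that are on no facet except those adjacent to `v`. -/
def U : Set (Fin n → ℂ) := {ξ | ∀ r, r ∉ Set.range c.facetAt → 0 < P.l r (c.moment ξ)}

/-- The holomorphic vertex coordinates `w_v^j = exp (∂g/∂x_v^j + i θ_v^j)` determined by the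
potential `g`, extended continuously from the open orbit to `U_v`. (On the open orbit
`e^{i θ_v^j} = ξ_j / |ξ_j|`, and `∂/∂x_v^j` is the `j`-th column of `A_v⁻¹`.) -/
def w (g : (Fin n → ℝ) → ℝ) (j : Fin n) : (Fin n → ℂ) → ℂ :=
  extendFrom {ξ | ξ ∈ c.U ∧ c.moment ξ ∈ interior P.carrier} fun ξ =>
    (Real.exp (fderiv ℝ g (c.moment ξ) (c.A⁻¹ *ᵥ Pi.single j 1)) : ℂ) * (ξ j / (‖ξ j‖ : ℂ))

/-- The Kähler polarization determined by the potential `g`: the holomorphic tangent space of the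
complex structure with holomorphic coordinates `w_v^j`, i.e. the common kernel of the `d w̄_v^j`. -/
def kahlerPolarization (g : (Fin n → ℝ) → ℝ) (ξ : Fin n → ℂ) : Submodule ℂ (TangentC n) :=
  ⨅ j, LinearMap.ker (differentialC (fun η => starRingEnd ℂ (c.w g j η)) ξ)

/-- `W_j = ∂/∂w_v^j` at `ξ` for all `j`: `dw_v^k (W_j) = δ_{jk}` and `dw̄_v^k (W_j) = 0`, where
the coordinates `w_v^k` are those of the potential `g` (and are differentiable at `ξ`). -/
def IsHolomorphicFrame (g : (Fin n → ℝ) → ℝ) (ξ : Fin n → ℂ) (W : Fin n → TangentC n) : Prop :=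
  (∀ k, DifferentiableAt ℝ (c.w g k) ξ) ∧
  ∀ j k, differentialC (c.w g k) ξ (W j) = (if j = k then 1 else 0) ∧
    differentialC (fun η => starRingEnd ℂ (c.w g k η)) ξ (W j) = 0

/-- `∂/∂x_v^k = |ξ_k|⁻² (u_k ∂/∂u_k + v_k ∂/∂v_k)`, for `ξ_k ≠ 0`. -/
def dx (_c : P.VertexChart) (ξ : Fin n → ℂ) (k : Fin n) : TangentC n :=
  (Pi.single k (((ξ k).re / ‖ξ k‖ ^ 2 : ℝ) : ℂ), Pi.single k (((ξ k).im / ‖ξ k‖ ^ 2 : ℝ) : ℂ))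

/-- `∂/∂θ_v^k = u_k ∂/∂v_k - v_k ∂/∂u_k`. -/
def dθ (_c : P.VertexChart) (ξ : Fin n → ℂ) (k : Fin n) : TangentC n :=
  (Pi.single k ((-(ξ k).im : ℝ) : ℂ), Pi.single k (((ξ k).re : ℝ) : ℂ))

open Classical in
/-- The set of indices `j ∈ F`, for a face `F`: those with `w_v^j = 0` along `μ⁻¹(F) ∩ U_v`. -/
def faceIndices (g : (Fin n → ℝ) → ℝ) (F : Set (Fin n → ℝ)) : Finset (Fin n) :=
  Finset.univ.filter fun j => ∀ ξ ∈ c.U, c.moment ξ ∈ F → c.w g j ξ = 0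

/-- The vectors `∑_{k ∉ I} M_{jk} ∂/∂x_v^k - i ∂/∂θ_v^j`. -/
def mixedVector (ξ : Fin n → ℂ) (I : Finset (Fin n)) (M : Matrix (Fin n) (Fin n) ℝ) (j : Fin n) :
    TangentC n :=
  (∑ k ∈ Iᶜ, (M j k : ℂ) • c.dx ξ k) - Complex.I • c.dθ ξ j

/-- `Ã_v = A_v B⁻¹`. -/
def Atilde (B : SpecialLinearGroup (Fin n) ℤ) : Matrix (Fin n) (Fin n) ℝ :=
  c.A * ((B : Matrix (Fin n) (Fin n) ℤ).map (Int.cast : ℤ → ℝ))⁻¹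

/-- `∂/∂x̃^l = ∑_k (Ã_v)_{kl} ∂/∂x_v^k` over the face with index set `I`, where the coordinates
along the face are the `x_v^k`, `k ∉ I`. It is only used in combinations whose `∂/∂x_v^k` component
vanishes for each `k ∈ I`. -/
def dxtilde (B : SpecialLinearGroup (Fin n) ℤ) (ξ : Fin n → ℂ) (I : Finset (Fin n)) (l : Fin n) :
    TangentC n :=
  ∑ k ∈ Iᶜ, (c.Atilde B k l : ℂ) • c.dx ξ k

end DelzantPolytope.VertexChart

/-- The real matrix `B⁻¹`; its columns are the coordinate vector fields of `x̃ = B x`. -/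
def invReal {n : ℕ} (B : SpecialLinearGroup (Fin n) ℤ) : Matrix (Fin n) (Fin n) ℝ :=
  ((B : Matrix (Fin n) (Fin n) ℤ).map (Int.cast : ℤ → ℝ))⁻¹

/-- `H = ½ ∑_{j ≤ p} x̃_j²`, where `x̃ = B x`. -/
def hamiltonian {n : ℕ} (B : SpecialLinearGroup (Fin n) ℤ) (p : ℕ) (x : Fin n → ℝ) : ℝ :=
  (1 / 2) * ∑ j : {j : Fin n // (j : ℕ) < p},
    (((B : Matrix (Fin n) (Fin n) ℤ).map (Int.cast : ℤ → ℝ)) *ᵥ x) j ^ 2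

/-- The family of potentials `g_s = g + s H`. -/
def potentialRay {n : ℕ} (B : SpecialLinearGroup (Fin n) ℤ) (p : ℕ) (g : (Fin n → ℝ) → ℝ) (s : ℝ) :
    (Fin n → ℝ) → ℝ :=
  fun x => g x + s * hamiltonian B p x

/-- The lower right `(n - p) × (n - p)` diagonal block of a matrix. -/
def lowerBlock {n : ℕ} (p : ℕ) (M : Matrix (Fin n) (Fin n) ℝ) :
    Matrix {q : Fin n // p ≤ (q : ℕ)} {q : Fin n // p ≤ (q : ℕ)} ℝ :=
  M.submatrix Subtype.val Subtype.val

/-- The block matrix `diag(0, E)` with `E` of size `(n - p) × (n - p)`. -/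
def diagZero {n : ℕ} (p : ℕ) (E : Matrix {q : Fin n // p ≤ (q : ℕ)} {q : Fin n // p ≤ (q : ℕ)} ℝ) :
    Matrix (Fin n) (Fin n) ℝ :=
  Matrix.of fun q r =>
    if h : p ≤ (q : ℕ) ∧ p ≤ (r : ℕ) then E ⟨q, h.1⟩ ⟨r, h.2⟩ else 0

/-- `(G̃_s)⁻¹` on the interior of `P`: inverse Hessian of `g_s` in the coordinates `x̃`. -/
def Gtilde_inv {n : ℕ} (B : SpecialLinearGroup (Fin n) ℤ) (p : ℕ) (g : (Fin n → ℝ) → ℝ) (s : ℝ)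
    (x : Fin n → ℝ) : Matrix (Fin n) (Fin n) ℝ :=
  (hessianIn (invReal B) (potentialRay B p g s) x)⁻¹

/-- `(G̃_s^v)⁻¹` on the interior of `P`: inverse Hessian of `g_s` in the vertex coordinates. -/
def Gv_inv {n d : ℕ} {P : DelzantPolytope n d} (c : P.VertexChart)
    (B : SpecialLinearGroup (Fin n) ℤ) (p : ℕ) (g : (Fin n → ℝ) → ℝ) (s : ℝ)
    (x : Fin n → ℝ) : Matrix (Fin n) (Fin n) ℝ :=
  (hessianIn c.A⁻¹ (potentialRay B p g s) x)⁻¹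

/-- `D⁻¹` on the interior of `P`, `D` the lower diagonal block of the Hessian `G̃` of `g`. -/
def D_inv {n : ℕ} (B : SpecialLinearGroup (Fin n) ℤ) (p : ℕ) (g : (Fin n → ℝ) → ℝ)
    (x : Fin n → ℝ) : Matrix {q : Fin n // p ≤ (q : ℕ)} {q : Fin n // p ≤ (q : ℕ)} ℝ :=
  (lowerBlock p (hessianIn (invReal B) g x))⁻¹

/-- The vectors `∑_{q,l > p} (Ã_v)_{jq} (D⁻¹)_{(q-p)(l-p)} ∂/∂x̃^l - i ∂/∂θ_v^j`, with `E = D⁻¹`. -/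
def limitVector {n d : ℕ} {P : DelzantPolytope n d} (c : P.VertexChart)
    (B : SpecialLinearGroup (Fin n) ℤ) (p : ℕ) (ξ : Fin n → ℂ) (I : Finset (Fin n))
    (E : Matrix {q : Fin n // p ≤ (q : ℕ)} {q : Fin n // p ≤ (q : ℕ)} ℝ) (j : Fin n) :
    TangentC n :=
  (∑ q, ∑ l, ((c.Atilde B j q.1 * E q l : ℝ) : ℂ) • c.dxtilde B ξ I l.1) - Complex.I • c.dθ ξ j

end

/-! ### Linear algebra: inverses compressed to a kernel, with weights that may degenerate -/

section CompressedInverse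

variable {n : ℕ}

/-! Near a vertex the potential is `½ ∑ x_v^j log x_v^j + k` with `k` smooth up to the boundary, so
its Hessian in vertex coordinates is `G = R⁻² + S`, where `R = diag √(2 x_v^j) = diag |ξ_j|` and `S`
is the Hessian of `k`. All singularities disappear in `Q = R G R = 1 + R S R`. The determinant
condition keeps `det Q` nonzero at the boundary, hence `Q` is positive definite there, and `G⁻¹ = R
Q⁻¹ R` extends, with vanishing columns where `ξ_k = 0`. Likewise `w_v^j` is a positive smooth
function times `ξ_j`. The kernel of the `dw̄_v^j` is then computed from `G⁻¹ (1 + S R²) = R²`, a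
form of `G⁻¹ G = 1` that stays valid when `R` is singular, and a dimension count
(`kahlerPolarization_eq_span`). Where `ξ_j = 0`, `∂/∂w_v^j` is a multiple of `∂/∂ξ_j` for every
potential.

Passing to `g_s` adds `s R Nᵀ N R` to `Q`, with `N` the differential of `(x̃_1, …, x̃_p)`. Two
limits must be compared at a boundary point: that of `R Q_s⁻¹ R` as `s → ∞`, and that of `D⁻¹` from
the interior. In the interior, `V diag(0, D⁻¹) Vᵀ = R Θ R` with `V = Ã_v` and `Θ` the compression of
`Q⁻¹` determined by `ker N`. At the boundary `Θ` itself might not converge. But `0 ≤ Θ ≤ Q⁻¹` bounds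
it, so it converges along ultrafilters; each limit satisfies the equations `IsCompressedInverse`,
and these determine `R Θ`. Hence `R Θ R` converges (`exists_tendsto_compressedInverse`). The
matrices `Q_s⁻¹` are bounded in the same way and their limits satisfy the same equations
(`IsCompressedInverse.tendsto_inv_add_smul`), so the two limits agree (`exists_tendsto_D_inv`).

Finally the frame of the polarization depends continuously on the matrix and is linearly independent
for every matrix, so convergence of matrices gives convergence in the Grassmannian. -/

/-- Evaluate the quadratic form on `e_j + e_k` and on `e_j - e_k`. -/
theorem Matrix.PosSemidef.abs_apply_le {M : Matrix (Fin n) (Fin n) ℝ} (hM : M.PosSemidef)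
    (j k : Fin n) : |M j k| ≤ (M j j + M k k) / 2 := by
  have hsym : M k j = M j k := by simpa using hM.1.apply j k
  have h₁ := hM.dotProduct_mulVec_nonneg (Pi.single j 1 + Pi.single k 1)
  have h₂ := hM.dotProduct_mulVec_nonneg (Pi.single j 1 - Pi.single k 1)
  simp [mulVec_add, mulVec_sub, add_dotProduct, sub_dotProduct, hsym] at h₁ h₂
  rw [abs_le]
  constructor <;> linarith

/-- A symmetric `Θ` with `Θ Q Θ ≤ Θ` lies between `0` and `Q⁻¹`, hence has bounded entries. -/
theorem abs_apply_le_of_mul_mul_le {Q Θ : Matrix (Fin n) (Fin n) ℝ} (hQ : Q.PosDef)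
    (hΘ : Θᵀ = Θ) (h : (Θ - Θ * Q * Θ).PosSemidef) (j k : Fin n) :
    |Θ j k| ≤ (Q⁻¹ j j + Q⁻¹ k k) / 2 := by
  have hdet : IsUnit Q.det := (Matrix.isUnit_iff_isUnit_det _).1 hQ.isUnit
  have hQt : Qᵀ = Q := (conjTranspose_eq_transpose_of_trivial Q).symm.trans hQ.1
  have h₀ : Θ.PosSemidef := by
    have := h.add (hQ.posSemidef.conjTranspose_mul_mul_same Θ)
    simpa [hΘ] using this
  -- `Q⁻¹ - Θ = (Θ - Θ Q Θ) + (1 - Q Θ)ᵀ Q⁻¹ (1 - Q Θ)`.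
  have h₁ : (Q⁻¹ - Θ).PosSemidef := by
    have := h.add (hQ.inv.posSemidef.conjTranspose_mul_mul_same (1 - Q * Θ))
    convert this using 1
    simp only [conjTranspose_eq_transpose_of_trivial, transpose_sub, transpose_one, transpose_mul,
      hQt, hΘ]
    have e : (1 - Θ * Q) * Q⁻¹ * (1 - Q * Θ)
        = Q⁻¹ - Q⁻¹ * Q * Θ - Θ * (Q * Q⁻¹) + Θ * (Q * Q⁻¹) * Q * Θ := by noncomm_ring
    rw [e, mul_nonsing_inv _ hdet, nonsing_inv_mul _ hdet]
    noncomm_ring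
  have hj := h₁.diag_nonneg (i := j)
  have hk := h₁.diag_nonneg (i := k)
  have := h₀.abs_apply_le j k
  rw [Matrix.sub_apply] at hj hk
  linarith

/-- `diag(ρ) Θ diag(ρ)` is the inverse of the compression of the form `diag(ρ)⁻¹ Q diag(ρ)⁻¹` to
`ker N`, where `ρ` may vanish in some of its entries. -/
def IsCompressedInverse (ρ : Fin n → ℝ) (Q N Θ : Matrix (Fin n) (Fin n) ℝ) : Prop :=
  N * diagonal ρ * Θ = 0 ∧
    ∀ z : Fin n → ℝ, N *ᵥ (ρ * z) = 0 → (∀ j, ρ j = 0 → z j = 0) → z ᵥ* (Q * Θ) = z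

/-- Only `diagonal ρ * Θ` is unique: rows of `Θ` with `ρ j = 0` are not controlled. For a difference
`Δ` of two solutions, the truncation `z` of `Δ w` to the indices with `ρ j ≠ 0` is an admissible
test vector, and the block form of `Q` gives `zᵀ Q z = zᵀ Q Δ w = 0`. -/
theorem IsCompressedInverse.diagonal_mul_eq {ρ : Fin n → ℝ} {Q N Θ Θ' : Matrix (Fin n) (Fin n) ℝ}
    (hQ : Q.PosDef) (hblock : ∀ j k, ρ j ≠ 0 → ρ k = 0 → Q j k = 0)
    (h : IsCompressedInverse ρ Q N Θ) (h' : IsCompressedInverse ρ Q N Θ') :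
    diagonal ρ * Θ = diagonal ρ * Θ' := by
  rw [← sub_eq_zero, ← mul_sub]
  set Δ := Θ - Θ' with hΔ
  have hN : N * diagonal ρ * Δ = 0 := by rw [hΔ, mul_sub, h.1, h'.1, sub_zero]
  have hz : ∀ z : Fin n → ℝ, N *ᵥ (ρ * z) = 0 → (∀ j, ρ j = 0 → z j = 0) →
      z ᵥ* (Q * Δ) = 0 := fun z h₁ h₂ => by
    rw [hΔ, mul_sub, vecMul_sub, h.2 z h₁ h₂, h'.2 z h₁ h₂, sub_self]
  suffices H : ∀ w : Fin n → ℝ, (diagonal ρ * Δ) *ᵥ w = 0 by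
    ext j k
    simpa using congrFun (H (Pi.single k 1)) j
  intro w
  set z : Fin n → ℝ := fun j => if ρ j = 0 then 0 else (Δ *ᵥ w) j with hzdef
  have hρz : ρ * z = (diagonal ρ * Δ) *ᵥ w := by
    ext j
    rw [← mulVec_mulVec, mulVec_diagonal]
    by_cases hj : ρ j = 0 <;> simp [z, hj]
  have h₁ : N *ᵥ (ρ * z) = 0 := by
    rw [hρz, mulVec_mulVec, ← Matrix.mul_assoc, hN, zero_mulVec]
  have h₂ := hz z h₁ (fun j hj => by simp [z, hj])
  have h₃ : z ⬝ᵥ Q *ᵥ z = 0 := by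
    have : z ⬝ᵥ Q *ᵥ z = z ⬝ᵥ Q *ᵥ (Δ *ᵥ w) := by
      simp only [dotProduct, mulVec, Finset.mul_sum]
      refine Finset.sum_congr rfl fun j _ => Finset.sum_congr rfl fun k _ => ?_
      by_cases hj : ρ j = 0
      · simp [z, hj]
      by_cases hk : ρ k = 0
      · simp [hblock j k hj hk]
      · have : z k = (Δ *ᵥ w) k := by simp [z, hk]
        rw [this]
        simp only [mulVec, dotProduct, Finset.mul_sum]
    rw [this, mulVec_mulVec, dotProduct_mulVec, h₂, zero_dotProduct]
  have hz0 : z = 0 := by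
    by_contra hne
    have := hQ.dotProduct_mulVec_pos hne
    simp [h₃] at this
  rw [← hρz, hz0, mul_zero]

theorem exists_tendsto_of_eventually_abs_le {X : Type*} {u : Ultrafilter X}
    {Θ : X → Matrix (Fin n) (Fin n) ℝ} {K : ℝ} (h : ∀ᶠ x in (u : Filter X), ∀ j k, |Θ x j k| ≤ K) :
    ∃ Θ₀, Tendsto Θ u (𝓝 Θ₀) := by
  have hc : IsCompact (Set.Icc (fun _ _ => -K) (fun _ _ => K) : Set (Fin n → Fin n → ℝ)) :=
    isCompact_Icc
  have hmem : ∀ᶠ x in (u : Filter X),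
      (Θ x : Fin n → Fin n → ℝ) ∈ (Set.Icc (fun _ _ => -K) (fun _ _ => K)) := by
    filter_upwards [h] with x hx
    exact ⟨fun j k => (abs_le.1 (hx j k)).1, fun j k => (abs_le.1 (hx j k)).2⟩
  obtain ⟨Θ₀, -, hΘ₀⟩ := hc.ultrafilter_le_nhds' (u.map Θ) hmem
  exact ⟨Θ₀, hΘ₀⟩

variable {X : Type*} {l : Filter X} {ρ : X → Fin n → ℝ} {Q Θ : X → Matrix (Fin n) (Fin n) ℝ}
  {N : Matrix (Fin n) (Fin n) ℝ} {ρ₀ : Fin n → ℝ} {Q₀ : Matrix (Fin n) (Fin n) ℝ}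

theorem eventually_abs_apply_le (hQ₀ : Q₀.PosDef) (hQ : Tendsto Q l (𝓝 Q₀))
    (hpd : ∀ᶠ x in l, (Q x).PosDef) (hsymm : ∀ᶠ x in l, (Θ x)ᵀ = Θ x)
    (hle : ∀ᶠ x in l, (Θ x - Θ x * Q x * Θ x).PosSemidef) :
    ∃ K : ℝ, ∀ᶠ x in l, ∀ j k, |Θ x j k| ≤ K := by
  have hdet : IsUnit Q₀.det := (Matrix.isUnit_iff_isUnit_det _).1 hQ₀.isUnit
  have hinv : Tendsto (fun x => (Q x)⁻¹) l (𝓝 Q₀⁻¹) := by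
    have : ContinuousAt (fun M : Matrix (Fin n) (Fin n) ℝ => M⁻¹) Q₀ := by
      refine continuousAt_matrix_inv _ ?_
      have : ContinuousAt (fun x : ℝ => x⁻¹) Q₀.det := continuousAt_inv₀ hdet.ne_zero
      simpa [Ring.inverse_eq_inv'] using this
    exact this.tendsto.comp hQ
  -- The diagonal of `(Q x)⁻¹` is eventually within `1` of that of `Q₀⁻¹`; the sum gives one bound
  -- for all indices.
  refine ⟨∑ j, (|Q₀⁻¹ j j| + 1), ?_⟩
  have hent : ∀ᶠ x in l, ∀ j, (Q x)⁻¹ j j ≤ |Q₀⁻¹ j j| + 1 := by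
    refine eventually_all.2 fun j => ?_
    have : Tendsto (fun x => (Q x)⁻¹ j j) l (𝓝 (Q₀⁻¹ j j)) :=
      ((continuous_apply_apply j j).tendsto _).comp hinv
    exact this.eventually_le_const (by linarith [le_abs_self (Q₀⁻¹ j j)])
  filter_upwards [hpd, hsymm, hle, hent] with x h₁ h₂ h₃ h₄ j k
  have hs : ∀ i, (|Q₀⁻¹ i i| + 1) ≤ ∑ j, (|Q₀⁻¹ j j| + 1) := fun i =>
    Finset.single_le_sum (f := fun j => |Q₀⁻¹ j j| + 1) (fun _ _ => by positivity)
      (Finset.mem_univ i)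
  have := abs_apply_le_of_mul_mul_le h₁ h₂ h₃ j k
  linarith [h₄ j, h₄ k, hs j, hs k]

theorem IsCompressedInverse.of_tendsto {Θ₀ : Matrix (Fin n) (Fin n) ℝ} [NeBot l]
    (hρ : Tendsto ρ l (𝓝 ρ₀)) (hQ : Tendsto Q l (𝓝 Q₀)) (hΘ : Tendsto Θ l (𝓝 Θ₀))
    (h : ∀ᶠ x in l, IsCompressedInverse (ρ x) (Q x) N (Θ x)) :
    IsCompressedInverse ρ₀ Q₀ N Θ₀ := by
  have hdiag : Tendsto (fun x => diagonal (ρ x)) l (𝓝 (diagonal ρ₀)) :=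
    ((continuous_id.matrix_diagonal).tendsto ρ₀).comp hρ
  constructor
  · have h₁ : Tendsto (fun x => N * diagonal (ρ x) * Θ x) l (𝓝 (N * diagonal ρ₀ * Θ₀)) :=
      (tendsto_const_nhds.mul hdiag).mul hΘ
    refine tendsto_nhds_unique h₁ (tendsto_const_nhds.congr' ?_)
    filter_upwards [h] with x hx using hx.1.symm
  · intro z hz hz0
    -- A test vector `z` for the limit need not be one for `ρ x`. This correction satisfies `ρ x * ζ
    -- x = ρ₀ * z`, which lies in `ker N`, and converges to `z` because `z j = 0` wherever `ρ₀ j =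
    -- 0`.
    set ζ : X → Fin n → ℝ := fun x j => (ρ x j)⁻¹ * (ρ₀ j * z j) with hζdef
    have hρj : ∀ j, Tendsto (fun x => ρ x j) l (𝓝 (ρ₀ j)) := fun j =>
      ((continuous_apply j).tendsto _).comp hρ
    have hζ : Tendsto ζ l (𝓝 z) := by
      refine tendsto_pi_nhds.2 fun j => ?_
      by_cases hj : ρ₀ j = 0
      · simp [ζ, hj, hz0 j hj]
      · have := ((hρj j).inv₀ hj).mul_const (ρ₀ j * z j)
        rwa [inv_mul_cancel_left₀ hj] at this
    have h₂ : Tendsto (fun x => ζ x ᵥ* (Q x * Θ x)) l (𝓝 (z ᵥ* (Q₀ * Θ₀))) := by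
      have : Continuous fun q : (Fin n → ℝ) × Matrix (Fin n) (Fin n) ℝ => q.1 ᵥ* q.2 := by
        fun_prop
      exact (this.tendsto (z, Q₀ * Θ₀)).comp (hζ.prodMk_nhds (hQ.mul hΘ))
    refine tendsto_nhds_unique h₂ (hζ.congr' ?_)
    have hne : ∀ᶠ x in l, ∀ j, ρ₀ j ≠ 0 → ρ x j ≠ 0 := by
      refine eventually_all.2 fun j => ?_
      by_cases hj : ρ₀ j = 0
      · simp [hj]
      · filter_upwards [(hρj j).eventually_ne hj] with x hx _ using hx
    filter_upwards [h, hne] with x hx hne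
    refine (hx.2 (ζ x) ?_ ?_).symm
    · have : ρ x * ζ x = ρ₀ * z := by
        ext j
        by_cases hj : ρ₀ j = 0
        · simp [ζ, hj]
        · simp [ζ, mul_inv_cancel_left₀ (hne j hj)]
      rw [this, hz]
    · intro j hj
      simp [ζ, hj]

/-- The compressed inverses of converging data converge, also if some of the weights `ρ` tend to
zero. -/
theorem exists_tendsto_compressedInverse [NeBot l] (hQ₀ : Q₀.PosDef)
    (hblock : ∀ j k, ρ₀ j ≠ 0 → ρ₀ k = 0 → Q₀ j k = 0)
    (hρ : Tendsto ρ l (𝓝 ρ₀)) (hQ : Tendsto Q l (𝓝 Q₀))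
    (hpd : ∀ᶠ x in l, (Q x).PosDef) (hsymm : ∀ᶠ x in l, (Θ x)ᵀ = Θ x)
    (hle : ∀ᶠ x in l, (Θ x - Θ x * Q x * Θ x).PosSemidef)
    (h : ∀ᶠ x in l, IsCompressedInverse (ρ x) (Q x) N (Θ x)) :
    ∃ Θ₀, IsCompressedInverse ρ₀ Q₀ N Θ₀ ∧
      Tendsto (fun x => diagonal (ρ x) * Θ x * diagonal (ρ x)) l
        (𝓝 (diagonal ρ₀ * Θ₀ * diagonal ρ₀)) := by
  obtain ⟨K, hK⟩ := eventually_abs_apply_le hQ₀ hQ hpd hsymm hle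
  have key : ∀ u : Ultrafilter X, (u : Filter X) ≤ l → ∃ Θ₀, Tendsto Θ u (𝓝 Θ₀) ∧
      IsCompressedInverse ρ₀ Q₀ N Θ₀ := by
    intro u hu
    obtain ⟨Θ₀, hΘ₀⟩ := exists_tendsto_of_eventually_abs_le (hK.filter_mono hu)
    exact ⟨Θ₀, hΘ₀, .of_tendsto (hρ.mono_left hu) (hQ.mono_left hu) hΘ₀ (h.filter_mono hu)⟩
  obtain ⟨Θ₀, -, hΘ₀⟩ := key (Ultrafilter.of l) (Ultrafilter.of_le l)
  refine ⟨Θ₀, hΘ₀, (tendsto_iff_ultrafilter _ _ _).2 fun u hu => ?_⟩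
  obtain ⟨Θ₁, h₁, h₁'⟩ := key u hu
  have hdiag : Tendsto (fun x => diagonal (ρ x)) u (𝓝 (diagonal ρ₀)) :=
    ((continuous_id.matrix_diagonal).tendsto ρ₀).comp (hρ.mono_left hu)
  -- Different ultrafilters may give different limits `Θ₁`, but all have the same product with
  -- `diagonal ρ₀`.
  rw [hΘ₀.diagonal_mul_eq hQ₀ hblock h₁']
  exact (hdiag.mul h₁).mul hdiag

/-- Adding a large multiple of a degenerate form compresses the inverse to the kernel of the
form. -/
theorem IsCompressedInverse.tendsto_inv_add_smul {Θ₀ : Matrix (Fin n) (Fin n) ℝ} (hQ₀ : Q₀.PosDef)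
    (hblock : ∀ j k, ρ₀ j ≠ 0 → ρ₀ k = 0 → Q₀ j k = 0) (hΘ₀ : IsCompressedInverse ρ₀ Q₀ N Θ₀) :
    Tendsto (fun s : ℝ => diagonal ρ₀ *
        (Q₀ + s • (diagonal ρ₀ * (Nᵀ * N) * diagonal ρ₀))⁻¹ * diagonal ρ₀) atTop
      (𝓝 (diagonal ρ₀ * Θ₀ * diagonal ρ₀)) := by
  set T : Matrix (Fin n) (Fin n) ℝ := diagonal ρ₀ * (Nᵀ * N) * diagonal ρ₀ with hTdef
  have hT' : T = (N * diagonal ρ₀)ᵀ * (N * diagonal ρ₀) := by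
    simp [hTdef, transpose_mul, Matrix.mul_assoc]
  have hT : T.PosSemidef := by
    rw [hT']
    exact posSemidef_conjTranspose_mul_self (N * diagonal ρ₀)
  set Φ : ℝ → Matrix (Fin n) (Fin n) ℝ := fun s => (Q₀ + s • T)⁻¹ with hΦdef
  have hpd : ∀ s : ℝ, 0 ≤ s → (Q₀ + s • T).PosDef := fun s hs =>
    hQ₀.add_posSemidef (hT.smul hs)
  have hdet : ∀ s : ℝ, 0 ≤ s → IsUnit (Q₀ + s • T).det := fun s hs =>
    (Matrix.isUnit_iff_isUnit_det _).1 (hpd s hs).isUnit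
  have hsymm : ∀ s : ℝ, 0 ≤ s → (Φ s)ᵀ = Φ s := fun s hs => by
    exact (conjTranspose_eq_transpose_of_trivial (Φ s)).symm.trans (hpd s hs).inv.1
  -- From `Φ (Q₀ + s T) Φ = Φ` the difference is `Φ (s T) Φ`.
  have hle : ∀ s : ℝ, 0 ≤ s → (Φ s - Φ s * Q₀ * Φ s).PosSemidef := fun s hs => by
    have h₁ := ((hT.smul hs).conjTranspose_mul_mul_same (Φ s))
    convert h₁ using 1
    have e : Φ s * (Q₀ + s • T) * Φ s = Φ s := by
      rw [nonsing_inv_mul _ (hdet s hs), one_mul]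
    rw [conjTranspose_eq_transpose_of_trivial, hsymm s hs]
    nth_rewrite 1 [← e]
    noncomm_ring
  obtain ⟨K, hK⟩ := eventually_abs_apply_le (l := atTop) (Θ := Φ) hQ₀ tendsto_const_nhds
    (.of_forall fun _ => hQ₀) ((eventually_ge_atTop 0).mono hsymm)
    ((eventually_ge_atTop 0).mono hle)
  refine (tendsto_iff_ultrafilter _ _ _).2 fun u hu => ?_
  obtain ⟨Θ₁, hΘ₁⟩ := exists_tendsto_of_eventually_abs_le (hK.filter_mono hu)
  have hu0 : ∀ᶠ s : ℝ in (u : Filter ℝ), 0 < s := (eventually_gt_atTop 0).filter_mono hu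
  have hQΦ : ∀ s : ℝ, 0 ≤ s → Q₀ * Φ s = 1 - s • (T * Φ s) := fun s hs => by
    have := mul_nonsing_inv _ (hdet s hs)
    rw [add_mul, smul_mul_assoc] at this
    rw [← this]
    simp [Φ]
  have hchar : IsCompressedInverse ρ₀ Q₀ N Θ₁ := by
    constructor
    · have h₁ : Tendsto (fun s => T * Φ s) u (𝓝 (T * Θ₁)) := tendsto_const_nhds.mul hΘ₁
      have h₂ : Tendsto (fun s : ℝ => s⁻¹ • (1 - Q₀ * Φ s)) u (𝓝 ((0 : ℝ) • (1 - Q₀ * Θ₁))) :=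
        (tendsto_inv_atTop_zero.mono_left hu).smul
          (tendsto_const_nhds.sub (tendsto_const_nhds.mul hΘ₁))
      have h₃ : T * Θ₁ = 0 := by
        rw [← zero_smul ℝ (1 - Q₀ * Θ₁)]
        refine tendsto_nhds_unique h₁ (h₂.congr' ?_)
        filter_upwards [hu0] with s hs
        rw [hQΦ s hs.le, sub_sub_cancel, smul_smul, inv_mul_cancel₀ hs.ne', one_smul]
      rw [hT', ← conjTranspose_eq_transpose_of_trivial, Matrix.mul_assoc,
        ← Matrix.mul_assoc, conjTranspose_mul_self_mul_eq_zero] at h₃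
      exact h₃
    · intro z hz _
      -- Such a `z` does not see the added term, so `z ᵥ* (Q₀ * Φ s) = z` already for each finite
      -- `s`.
      have hzT : z ᵥ* T = 0 := by
        rw [hT', ← vecMul_vecMul, vecMul_transpose, ← mulVec_mulVec]
        have : diagonal ρ₀ *ᵥ z = ρ₀ * z := by ext j; simp [mulVec_diagonal]
        rw [this, hz, zero_vecMul]
      have h₁ : Tendsto (fun s => z ᵥ* (Q₀ * Φ s)) u (𝓝 (z ᵥ* (Q₀ * Θ₁))) := by
        have : Continuous fun M : Matrix (Fin n) (Fin n) ℝ => z ᵥ* M := by fun_prop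
        exact (this.tendsto _).comp (tendsto_const_nhds.mul hΘ₁)
      refine tendsto_nhds_unique h₁ (tendsto_const_nhds.congr' ?_)
      filter_upwards [hu0] with s hs
      rw [hQΦ s hs.le, vecMul_sub, vecMul_one, vecMul_smul, ← vecMul_vecMul, hzT, zero_vecMul,
        smul_zero, sub_zero]
  rw [hΘ₀.diagonal_mul_eq hQ₀ hblock hchar]
  exact (tendsto_const_nhds.mul hΘ₁).mul tendsto_const_nhds

end CompressedInverse

/-! ### The polytope, its interior, and the vertex chart -/

noncomputable section

namespace DelzantPolytope

variable {n d : ℕ} (P : DelzantPolytope n d)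

/-- The linear part of `l_r`. -/
def dl (r : Fin d) : (Fin n → ℝ) →L[ℝ] ℝ :=
  ∑ k, (P.ν r k : ℝ) • ContinuousLinearMap.proj k

theorem dl_apply (r : Fin d) (v : Fin n → ℝ) : P.dl r v = ∑ k, v k * (P.ν r k : ℝ) := by
  simp [dl, mul_comm]

theorem l_eq (r : Fin d) (x : Fin n → ℝ) : P.l r x = P.dl r x + P.lam r := by
  rw [dl_apply, l]

theorem l_add (r : Fin d) (x v : Fin n → ℝ) : P.l r (x + v) = P.l r x + P.dl r v := by
  rw [l_eq, l_eq, map_add]; ring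

theorem hasFDerivAt_l (r : Fin d) (x : Fin n → ℝ) : HasFDerivAt (P.l r) (P.dl r) x := by
  have : P.l r = fun x => P.dl r x + P.lam r := funext (P.l_eq r)
  rw [this]
  exact (P.dl r).hasFDerivAt.add_const _

theorem contDiff_l (r : Fin d) : ContDiff ℝ ∞ (P.l r) := by
  have : P.l r = fun x => P.dl r x + P.lam r := funext (P.l_eq r)
  rw [this]
  exact (P.dl r).contDiff.add contDiff_const

theorem continuous_l (r : Fin d) : Continuous (P.l r) := (P.contDiff_l r).continuous

theorem l_combo (r : Fin d) {x y : Fin n → ℝ} {a b : ℝ} (hab : a + b = 1) :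
    P.l r (a • x + b • y) = a * P.l r x + b * P.l r y := by
  simp only [l_eq, map_add, map_smul, smul_eq_mul]
  linear_combination (-P.lam r) * hab

theorem exists_ν_ne_zero (r : Fin d) : ∃ k, P.ν r k ≠ 0 := by
  by_contra! h
  exact not_isUnit_zero (P.primitive r 0 fun k => by simp [h k])

/-- Primitive normals are nonzero, so moving along `-ν_r` strictly decreases `l_r`; an interior
point therefore cannot have `l_r = 0`. -/
theorem mem_interior_carrier {x : Fin n → ℝ} : x ∈ interior P.carrier ↔ ∀ r, 0 < P.l r x := by
  constructor
  · intro hx r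
    obtain ⟨k, hk⟩ := P.exists_ν_ne_zero r
    have hcont : Tendsto (fun t : ℝ => x + t • (fun k => -(P.ν r k : ℝ))) (𝓝[>] 0) (𝓝 x) := by
      have : Continuous (fun t : ℝ => x + t • (fun k => -(P.ν r k : ℝ))) := by fun_prop
      simpa using (this.tendsto 0).mono_left nhdsWithin_le_nhds
    have hev : ∀ᶠ t : ℝ in 𝓝[>] 0, x + t • (fun k => -(P.ν r k : ℝ)) ∈ P.carrier :=
      hcont (mem_interior_iff_mem_nhds.1 hx)
    obtain ⟨t, ht, ht0⟩ := (hev.and self_mem_nhdsWithin).exists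
    have h₁ := ht r
    rw [l_add, map_smul, dl_apply, smul_eq_mul] at h₁
    have h₂ : 0 < ∑ k, (P.ν r k : ℝ) * (P.ν r k : ℝ) :=
      Finset.sum_pos' (fun i _ => mul_self_nonneg _)
        ⟨k, Finset.mem_univ k, mul_self_pos.2 (by exact_mod_cast hk)⟩
    simp only [neg_mul, Finset.sum_neg_distrib] at h₁
    have ht0 : 0 < t := ht0
    nlinarith [mul_pos ht0 h₂]
  · intro hx
    rw [mem_interior_iff_mem_nhds]
    have : ∀ᶠ y in 𝓝 x, ∀ r, 0 < P.l r y :=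
      eventually_all.2 fun r => (P.continuous_l r).continuousAt.eventually (lt_mem_nhds (hx r))
    filter_upwards [this] with y hy r using (hy r).le

theorem convex_carrier : Convex ℝ P.carrier := by
  intro x hx y hy a b ha hb hab r
  rw [P.l_combo r hab]
  have := hx r; have := hy r
  positivity

/-- Makes limits from the interior unique at every point of `P`, so that boundary values are
determined. -/
theorem carrier_subset_closure_interior : P.carrier ⊆ closure (interior P.carrier) :=
  subset_closure.trans
    (P.convex_carrier.closure_interior_eq_closure_of_nonempty_interior P.interior_nonempty).ge

end DelzantPolytope

namespace DelzantPolytope.VertexChart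

variable {n d : ℕ} {P : DelzantPolytope n d} (c : P.VertexChart)

/-- The Delzant condition speaks of some enumeration of the facets at `v`; that of the chart differs
from it by a permutation, which changes the determinant only by a sign. -/
theorem isUnit_det_A : IsUnit c.A.det := by
  obtain ⟨σ, hσ, hact, hdet⟩ := P.vertex c.v c.isVertex
  have hmem : ∀ j, ∃ i, σ i = c.facetAt j := fun j =>
    (hact _).1 ((c.active _).2 ⟨j, rfl⟩)
  choose τ hτ using hmem
  have hτinj : Function.Injective τ := fun i j hij => c.injective (by rw [← hτ, ← hτ, hij])
  let e : Equiv.Perm (Fin n) := Equiv.ofBijective τ (Finite.injective_iff_bijective.1 hτinj)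
  have hA : c.A = ((Matrix.of fun j k => P.ν (σ j) k).submatrix e id).map (Int.castRingHom ℝ) := by
    ext j k
    simp [A, e, hτ]
  have h₁ : IsUnit (((Matrix.of fun j k => P.ν (σ j) k).submatrix e id).det) := by
    rw [det_permute]
    exact (Equiv.Perm.sign e).isUnit.mul hdet
  rw [hA, ← RingHom.mapMatrix_apply, ← RingHom.map_det]
  exact h₁.map _

theorem A_mulVec (x : Fin n → ℝ) (j : Fin n) : (c.A *ᵥ x) j = P.dl (c.facetAt j) x := by
  simp [A, mulVec, dotProduct, dl_apply, mul_comm]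

/-- The coordinate vector fields `∂/∂x_v^k`. -/
def e (k : Fin n) : Fin n → ℝ := c.A⁻¹ *ᵥ Pi.single k 1

theorem dl_facetAt_e (j k : Fin n) : P.dl (c.facetAt j) (c.e k) = if j = k then 1 else 0 := by
  rw [← c.A_mulVec, e, mulVec_mulVec, mul_nonsing_inv _ c.isUnit_det_A, one_mulVec]
  simp [Pi.single_apply]

theorem sum_smul_e (y : Fin n → ℝ) : c.A⁻¹ *ᵥ y = ∑ k, y k • c.e k := by
  ext i
  simp [e, mulVec, dotProduct, mul_comm]

theorem l_facetAt_moment (ξ : Fin n → ℂ) (j : Fin n) :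
    P.l (c.facetAt j) (c.moment ξ) = ‖ξ j‖ ^ 2 / 2 := by
  rw [l_eq, ← c.A_mulVec, moment, mulVec_mulVec, mul_nonsing_inv _ c.isUnit_det_A, one_mulVec]
  ring

/-- The part of the polytope below `U_v`. -/
def region : Set (Fin n → ℝ) :=
  {x | x ∈ P.carrier ∧ ∀ r, r ∉ Set.range c.facetAt → 0 < P.l r x}

theorem region_subset : c.region ⊆ P.carrier := fun _ hx => hx.1

theorem interior_subset_region : interior P.carrier ⊆ c.region := fun _ hx =>
  ⟨interior_subset hx, fun r _ => P.mem_interior_carrier.1 hx r⟩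

theorem convex_region : Convex ℝ c.region := by
  intro _ hx _ hy a b ha hb hab
  refine ⟨P.convex_carrier hx.1 hy.1 ha hb hab, fun r hr => ?_⟩
  rw [P.l_combo r hab]
  have h₁ := hx.2 r hr; have h₂ := hy.2 r hr
  rcases ha.eq_or_lt with rfl | ha'
  · simp only [zero_add] at hab
    simpa [hab] using h₂
  · positivity

theorem uniqueDiffOn_region : UniqueDiffOn ℝ c.region :=
  uniqueDiffOn_convex c.convex_region
    (P.interior_nonempty.mono (interior_maximal c.interior_subset_region isOpen_interior))

theorem moment_mem_region {ξ : Fin n → ℂ} (hξ : ξ ∈ c.U) : c.moment ξ ∈ c.region := by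
  refine ⟨fun r => ?_, hξ⟩
  by_cases hr : r ∈ Set.range c.facetAt
  · obtain ⟨j, rfl⟩ := hr
    rw [c.l_facetAt_moment]
    positivity
  · exact (hξ r hr).le

theorem continuous_moment : Continuous c.moment := by
  unfold moment
  fun_prop

theorem isOpen_U : IsOpen c.U := by
  have : c.U = ⋂ r, {ξ | r ∉ Set.range c.facetAt → 0 < P.l r (c.moment ξ)} := by
    ext; simp [U]
  rw [this]
  refine isOpen_iInter_of_finite fun r => ?_
  by_cases hr : r ∈ Set.range c.facetAt
  · simp [hr]
  · simp only [hr, not_false_eq_true, forall_true_left]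
    exact isOpen_lt continuous_const ((P.continuous_l r).comp c.continuous_moment)

theorem moment_mem_interior {ξ : Fin n → ℂ} (hξ : ξ ∈ c.U) :
    c.moment ξ ∈ interior P.carrier ↔ ∀ j, ξ j ≠ 0 := by
  rw [P.mem_interior_carrier]
  constructor
  · intro h j hj
    have := h (c.facetAt j)
    simp [c.l_facetAt_moment, hj] at this
  · intro h r
    by_cases hr : r ∈ Set.range c.facetAt
    · obtain ⟨j, rfl⟩ := hr
      rw [c.l_facetAt_moment]
      have := norm_pos_iff.2 (h j)
      positivity
    · exact hξ r hr

/-- Within `U_v` the open orbit is the set where no `ξ_j` vanishes, and that set is dense in `ℂⁿ`.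
-/
theorem mem_closure_openOrbit {ξ : Fin n → ℂ} (hξ : ξ ∈ c.U) :
    ξ ∈ closure {ξ | ξ ∈ c.U ∧ c.moment ξ ∈ interior P.carrier} := by
  have hd : Dense {ξ : Fin n → ℂ | ∀ j, ξ j ≠ 0} := by
    have h := dense_pi (Set.univ : Set (Fin n)) (s := fun _ => ({0}ᶜ : Set ℂ))
      fun _ _ => dense_compl_singleton 0
    convert h using 1
    ext; simp [Set.mem_pi]
  refine closure_mono ?_ (hd.open_subset_closure_inter c.isOpen_U hξ)
  exact fun η hη => ⟨hη.1, (c.moment_mem_interior hη.1).2 hη.2⟩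

/-- The differential `dy_k = u_k du_k + v_k dv_k` of `x_v^k = |ξ_k|² / 2`. -/
def dy (ξ : Fin n → ℂ) (k : Fin n) : (Fin n → ℂ) →L[ℝ] ℝ :=
  ((innerSL ℝ (ξ k) : ℂ →L[ℝ] ℝ)).comp (ContinuousLinearMap.proj k)

theorem hasFDerivAt_moment (ξ : Fin n → ℂ) :
    HasFDerivAt c.moment (∑ k, (dy ξ k).smulRight (c.e k)) ξ := by
  have h : c.moment = fun ξ => ∑ k, (‖ξ k‖ ^ 2 / 2 - P.lam (c.facetAt k)) • c.e k := by
    ext1 ξ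
    rw [moment, sum_smul_e]
  rw [h]
  refine HasFDerivAt.fun_sum fun k _ => HasFDerivAt.smul_const ?_ _
  have h₁ : HasFDerivAt (fun ξ : Fin n → ℂ => ξ k)
      (ContinuousLinearMap.proj k : (Fin n → ℂ) →L[ℝ] ℂ) ξ :=
    (ContinuousLinearMap.proj k : (Fin n → ℂ) →L[ℝ] ℂ).hasFDerivAt
  have h₂ := ((h₁.norm_sq).const_mul (1 / 2 : ℝ)).sub_const (P.lam (c.facetAt k))
  have h₃ : (fun ξ : Fin n → ℂ => ‖ξ k‖ ^ 2 / 2 - P.lam (c.facetAt k)) =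
      fun ξ => 1 / 2 * ‖ξ k‖ ^ 2 - P.lam (c.facetAt k) := by
    ext ξ; ring
  rw [h₃]
  exact h₂.congr_fderiv (by ext v; simp [dy]; ring)

end DelzantPolytope.VertexChart
end

/-! ### The potential near a vertex and its holomorphic coordinates -/

noncomputable section

namespace DelzantPolytope.VertexChart

variable {n d : ℕ} {P : DelzantPolytope n d} (c : P.VertexChart)

/-- `f` is `½ ∑ x_v^j log x_v^j` plus a function `k` smooth up to the boundary below `U_v`. -/
structure HasSmoothRemainder (f k : (Fin n → ℝ) → ℝ) : Prop where
  contDiffOn : ContDiffOn ℝ ∞ k c.region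
  eq_add : ∀ x ∈ interior P.carrier,
    f x = 1 / 2 * ∑ j, P.l (c.facetAt j) x * Real.log (P.l (c.facetAt j) x) + k x

/-- The derivatives `∂k/∂x_v^j`, up to the boundary. -/
def partialD (k : (Fin n → ℝ) → ℝ) (j : Fin n) (x : Fin n → ℝ) : ℝ :=
  fderivWithin ℝ k c.region x (c.e j)

/-- The Hessian of `k` in the vertex coordinates, up to the boundary. -/
def smoothHessian (k : (Fin n → ℝ) → ℝ) (x : Fin n → ℝ) : Matrix (Fin n) (Fin n) ℝ :=
  Matrix.of fun i j => fderivWithin ℝ (c.partialD k i) c.region x (c.e j)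

variable {c} {f k : (Fin n → ℝ) → ℝ}

theorem contDiffOn_partialD (hk : ContDiffOn ℝ ∞ k c.region) (j : Fin n) :
    ContDiffOn ℝ ∞ (c.partialD k j) c.region :=
  (hk.fderivWithin c.uniqueDiffOn_region (m := ∞) le_rfl).clm_apply contDiffOn_const

theorem continuousOn_smoothHessian (hk : ContDiffOn ℝ ∞ k c.region) :
    ContinuousOn (c.smoothHessian k) c.region := by
  refine continuousOn_pi.2 fun i => continuousOn_pi.2 fun j => ?_
  exact (((contDiffOn_partialD hk i).fderivWithin c.uniqueDiffOn_region (m := ∞)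
    le_rfl).clm_apply contDiffOn_const).continuousOn

theorem region_mem_nhds {x : Fin n → ℝ} (hx : x ∈ interior P.carrier) : c.region ∈ 𝓝 x :=
  mem_of_superset (isOpen_interior.mem_nhds hx) c.interior_subset_region

theorem l_facetAt_pos {x : Fin n → ℝ} (hx : x ∈ interior P.carrier) (j : Fin n) :
    0 < P.l (c.facetAt j) x := P.mem_interior_carrier.1 hx _

namespace HasSmoothRemainder

theorem contDiffAt (h : c.HasSmoothRemainder f k) {x : Fin n → ℝ} (hx : x ∈ interior P.carrier) :
    ContDiffAt ℝ ∞ f x := by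
  have h₁ : f =ᶠ[𝓝 x] fun x =>
      1 / 2 * ∑ j, P.l (c.facetAt j) x * Real.log (P.l (c.facetAt j) x) + k x := by
    filter_upwards [isOpen_interior.mem_nhds hx] with y hy using h.eq_add y hy
  refine ContDiffAt.congr_of_eventuallyEq (.add (contDiffAt_const.mul (.sum fun j _ => ?_))
    (h.contDiffOn.contDiffAt (region_mem_nhds hx))) h₁
  exact (P.contDiff_l _).contDiffAt.mul ((P.contDiff_l _).contDiffAt.log (l_facetAt_pos hx j).ne')

theorem fderiv_apply_e (h : c.HasSmoothRemainder f k) {x : Fin n → ℝ}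
    (hx : x ∈ interior P.carrier) (j : Fin n) :
    fderiv ℝ f x (c.e j) = 1 / 2 * (Real.log (P.l (c.facetAt j) x) + 1) + c.partialD k j x := by
  have h₁ : f =ᶠ[𝓝 x] fun x =>
      1 / 2 * ∑ j, P.l (c.facetAt j) x * Real.log (P.l (c.facetAt j) x) + k x := by
    filter_upwards [isOpen_interior.mem_nhds hx] with y hy using h.eq_add y hy
  have h₂ : ∀ i, HasFDerivAt (fun x => P.l (c.facetAt i) x * Real.log (P.l (c.facetAt i) x))
      ((Real.log (P.l (c.facetAt i) x) + 1) • P.dl (c.facetAt i)) x := fun i =>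
    (Real.hasDerivAt_mul_log (l_facetAt_pos hx i).ne').comp_hasFDerivAt x (P.hasFDerivAt_l _ x)
  have hkd : HasFDerivAt k (fderivWithin ℝ k c.region x) x :=
    ((h.contDiffOn.differentiableOn (by simp) x
      (c.interior_subset_region hx)).hasFDerivWithinAt).hasFDerivAt (region_mem_nhds hx)
  have h₃ := ((HasFDerivAt.fun_sum fun i (_ : i ∈ Finset.univ) => h₂ i).const_mul
    (1 / 2 : ℝ)).fun_add hkd
  rw [h₁.fderiv_eq, HasFDerivAt.fderiv h₃]
  simp [partialD, c.dl_facetAt_e]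

/-- The singular part is diagonal because `l` of the `i`-th adjacent facet depends on `x_v^i` alone.
-/
theorem hessianIn_eq (h : c.HasSmoothRemainder f k) {x : Fin n → ℝ}
    (hx : x ∈ interior P.carrier) :
    hessianIn c.A⁻¹ f x =
      diagonal (fun j => (2 * P.l (c.facetAt j) x)⁻¹) + c.smoothHessian k x := by
  ext i j
  have h₁ : (fun y => fderiv ℝ f y (c.e i)) =ᶠ[𝓝 x] fun y =>
      1 / 2 * (Real.log (P.l (c.facetAt i) y) + 1) + c.partialD k i y := by
    filter_upwards [isOpen_interior.mem_nhds hx] with y hy using h.fderiv_apply_e hy i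
  have h₂ : HasFDerivAt (c.partialD k i) (fderivWithin ℝ (c.partialD k i) c.region x) x :=
    (((contDiffOn_partialD h.contDiffOn i).differentiableOn (by simp) x
      (c.interior_subset_region hx)).hasFDerivWithinAt).hasFDerivAt (region_mem_nhds hx)
  have h₃ := ((((P.hasFDerivAt_l (c.facetAt i) x).log
    (l_facetAt_pos hx i).ne').add_const 1).const_mul (1 / 2 : ℝ)).fun_add h₂
  change fderiv ℝ (fun y => fderiv ℝ f y (c.e i)) x (c.e j) = _
  rw [h₁.fderiv_eq, HasFDerivAt.fderiv h₃]
  by_cases hij : i = j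
  · subst hij
    simp [smoothHessian, c.dl_facetAt_e]
    ring
  · simp [smoothHessian, c.dl_facetAt_e, hij]

end HasSmoothRemainder

/-- `w_v^j = scale_j ξ_j`, see `HasSmoothRemainder.w_eq`. -/
def scale (c : P.VertexChart) (k : (Fin n → ℝ) → ℝ) (j : Fin n) (ξ : Fin n → ℂ) : ℝ :=
  Real.exp (c.partialD k j (c.moment ξ) + 1 / 2) / √2

theorem scale_pos (j : Fin n) (ξ : Fin n → ℂ) : 0 < c.scale k j ξ := by
  unfold scale; positivity

/-- The remainder is differentiable only within the closed-sided region, but the moment map sends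
the open set `U_v` into that region, so the composition has a genuine derivative even over the
boundary. -/
theorem hasFDerivAt_partialD_moment (hk : ContDiffOn ℝ ∞ k c.region) {ξ : Fin n → ℂ}
    (hξ : ξ ∈ c.U) (j : Fin n) :
    HasFDerivAt (fun η => c.partialD k j (c.moment η))
      (∑ i, c.smoothHessian k (c.moment ξ) j i • dy ξ i) ξ := by
  have h₁ : HasFDerivWithinAt (c.partialD k j)
      (fderivWithin ℝ (c.partialD k j) c.region (c.moment ξ)) c.region (c.moment ξ) :=
    ((contDiffOn_partialD hk j).differentiableOn (by simp) _
      (c.moment_mem_region hξ)).hasFDerivWithinAt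
  have h₂ := (h₁.comp ξ (c.hasFDerivAt_moment ξ).hasFDerivWithinAt
    (fun η hη => c.moment_mem_region hη)).hasFDerivAt (c.isOpen_U.mem_nhds hξ)
  refine h₂.congr_fderiv ?_
  ext v
  simp [smoothHessian, map_sum, mul_comm]

theorem hasFDerivAt_scale (hk : ContDiffOn ℝ ∞ k c.region) {ξ : Fin n → ℂ}
    (hξ : ξ ∈ c.U) (j : Fin n) :
    HasFDerivAt (c.scale k j)
      (c.scale k j ξ • ∑ i, c.smoothHessian k (c.moment ξ) j i • dy ξ i) ξ := by
  have h₁ := (((hasFDerivAt_partialD_moment hk hξ j).add_const (1 / 2)).exp).mul_const (√2)⁻¹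
  have h₂ : c.scale k j = fun η => Real.exp (c.partialD k j (c.moment η) + 1 / 2) * (√2)⁻¹ := by
    ext η; rw [scale, div_eq_mul_inv]
  rw [h₂]
  refine h₁.congr_fderiv ?_
  rw [smul_smul, mul_comm]

/-- The logarithm in `∂f/∂x_v^j` exponentiates to `√(x_v^j) = |ξ_j| / √2`, which cancels the
denominator of `ξ_j / |ξ_j|`. What remains is continuous on `U_v`, hence is the extension. -/
theorem HasSmoothRemainder.w_eq (h : c.HasSmoothRemainder f k) {ξ : Fin n → ℂ} (hξ : ξ ∈ c.U)
    (j : Fin n) : c.w f j ξ = (c.scale k j ξ : ℂ) * ξ j := by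
  refine extendFrom_eq (c.mem_closure_openOrbit hξ) ?_
  have hcont : ContinuousAt (fun η : Fin n → ℂ => (c.scale k j η : ℂ) * η j) ξ :=
    (Complex.continuous_ofReal.continuousAt.comp
      (hasFDerivAt_scale h.contDiffOn hξ j).continuousAt).mul (continuous_apply j).continuousAt
  refine (hcont.tendsto.mono_left nhdsWithin_le_nhds).congr' ?_
  filter_upwards [self_mem_nhdsWithin] with η hη
  have h₁ := h.fderiv_apply_e hη.2 j
  have h₂ := (c.moment_mem_interior hη.1).1 hη.2 j
  have h₃ : 0 < ‖η j‖ := norm_pos_iff.2 h₂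
  have h₄ : Real.exp (fderiv ℝ f (c.moment η) (c.e j)) = c.scale k j η * ‖η j‖ := by
    rw [h₁, scale, c.l_facetAt_moment, Real.log_div (by positivity) two_ne_zero, Real.log_pow]
    have : 1 / 2 * (((2 : ℕ) : ℝ) * Real.log ‖η j‖ - Real.log 2 + 1) + c.partialD k j (c.moment η)
        = (c.partialD k j (c.moment η) + 1 / 2) + Real.log ‖η j‖ - Real.log 2 / 2 := by
      push_cast; ring
    rw [this, Real.exp_sub, Real.exp_add, Real.exp_log h₃, ← Real.log_sqrt (by norm_num),
      Real.exp_log (by positivity)]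
    ring
  change _ = (Real.exp (fderiv ℝ f (c.moment η) (c.e j)) : ℂ) * _
  rw [h₄]
  have h₅ : (‖η j‖ : ℂ) ≠ 0 := by exact_mod_cast h₃.ne'
  push_cast
  field_simp

/-- The complex linear extension of a real linear form on the tangent space. -/
def complexify (L : (Fin n → ℂ) →L[ℝ] ℂ) (V : TangentC n) : ℂ :=
  ∑ j, (V.1 j * L (Pi.single j 1) + V.2 j * L (Pi.single j Complex.I))

theorem complexify_add (L L' : (Fin n → ℂ) →L[ℝ] ℂ) (V : TangentC n) :
    complexify (L + L') V = complexify L V + complexify L' V := by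
  simp only [complexify, ← Finset.sum_add_distrib, _root_.add_apply]
  exact Finset.sum_congr rfl fun j _ => by ring

theorem complexify_smul (a : ℂ) (L : (Fin n → ℂ) →L[ℝ] ℂ) (V : TangentC n) :
    complexify (a • L) V = a * complexify L V := by
  simp only [complexify, Finset.mul_sum, _root_.smul_apply, smul_eq_mul]
  exact Finset.sum_congr rfl fun j _ => by ring

theorem complexify_comp_proj (m : ℂ →L[ℝ] ℂ) (j : Fin n) (V : TangentC n) :
    complexify (m.comp (ContinuousLinearMap.proj j)) V = V.1 j * m 1 + V.2 j * m Complex.I := by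
  rw [complexify, Finset.sum_eq_single j]
  · simp
  · intro i _ hi
    simp [hi.symm]
  · simp

/-- The complex linear extension of `dy_k = u_k du_k + v_k dv_k`. -/
def dyC (ξ : Fin n → ℂ) (k : Fin n) (V : TangentC n) : ℂ :=
  V.1 k * ((ξ k).re : ℂ) + V.2 k * ((ξ k).im : ℂ)

theorem complexify_ofReal_sum (a : Fin n → ℝ) (ξ : Fin n → ℂ) (V : TangentC n) :
    complexify (Complex.ofRealCLM.comp (∑ i, a i • dy ξ i)) V = ∑ i, (a i : ℂ) * dyC ξ i V := by
  have : Complex.ofRealCLM.comp (∑ i, a i • dy ξ i) =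
      ∑ i, (a i : ℂ) • (Complex.ofRealCLM.comp (innerSL ℝ (ξ i) : ℂ →L[ℝ] ℝ)).comp
        (ContinuousLinearMap.proj i) := by
    ext v
    simp [dy]
  rw [this]
  have hs : ∀ s : Finset (Fin n), complexify (∑ i ∈ s, (a i : ℂ) •
      (Complex.ofRealCLM.comp (innerSL ℝ (ξ i) : ℂ →L[ℝ] ℝ)).comp
        (ContinuousLinearMap.proj i)) V = ∑ i ∈ s, (a i : ℂ) * dyC ξ i V := by
    intro s
    induction s using Finset.induction_on with
    | empty => simp [complexify]
    | insert i s hi ih =>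
      rw [Finset.sum_insert hi, Finset.sum_insert hi, complexify_add, ih, complexify_smul,
        complexify_comp_proj]
      simp [dyC]
  exact hs _

/-- Here `m` is the identity for `w_v^j` and complex conjugation for its conjugate. -/
theorem hasFDerivAt_scale_mul (hk : ContDiffOn ℝ ∞ k c.region) {ξ : Fin n → ℂ}
    (hξ : ξ ∈ c.U) (m : ℂ →L[ℝ] ℂ) (j : Fin n) :
    HasFDerivAt (fun η => (c.scale k j η : ℂ) * m (η j))
      ((c.scale k j ξ : ℂ) • (m.comp (ContinuousLinearMap.proj j) + m (ξ j) •
        Complex.ofRealCLM.comp (∑ i, c.smoothHessian k (c.moment ξ) j i • dy ξ i))) ξ := by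
  have h₁ : HasFDerivAt (fun η : Fin n → ℂ => m (η j))
      (m.comp (ContinuousLinearMap.proj j)) ξ :=
    (m.comp (ContinuousLinearMap.proj j : (Fin n → ℂ) →L[ℝ] ℂ)).hasFDerivAt
  have h₂ := (Complex.ofRealCLM.hasFDerivAt.comp ξ (hasFDerivAt_scale hk hξ j)).mul h₁
  refine h₂.congr_fderiv ?_
  ext v
  simp
  ring

theorem differentialC_of_eqOn (hk : ContDiffOn ℝ ∞ k c.region) {ξ : Fin n → ℂ}
    (hξ : ξ ∈ c.U) (m : ℂ →L[ℝ] ℂ) (j : Fin n) {F : (Fin n → ℂ) → ℂ}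
    (hF : ∀ η ∈ c.U, F η = (c.scale k j η : ℂ) * m (η j)) (V : TangentC n) :
    DifferentiableAt ℝ F ξ ∧ differentialC F ξ V = c.scale k j ξ *
      (V.1 j * m 1 + V.2 j * m Complex.I + m (ξ j) *
        ∑ i, (c.smoothHessian k (c.moment ξ) j i : ℂ) * dyC ξ i V) := by
  have h₁ : F =ᶠ[𝓝 ξ] fun η => (c.scale k j η : ℂ) * m (η j) := by
    filter_upwards [c.isOpen_U.mem_nhds hξ] with η hη using hF η hη
  have h₂ := (hasFDerivAt_scale_mul hk hξ m j).congr_of_eventuallyEq h₁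
  refine ⟨h₂.differentiableAt, ?_⟩
  change complexify (fderiv ℝ F ξ) V = _
  rw [h₂.fderiv, complexify_smul, complexify_add, complexify_comp_proj, complexify_smul,
    complexify_ofReal_sum]

namespace HasSmoothRemainder

theorem differentiableAt_w (h : c.HasSmoothRemainder f k) {ξ : Fin n → ℂ}
    (hξ : ξ ∈ c.U) (j : Fin n) : DifferentiableAt ℝ (c.w f j) ξ :=
  (differentialC_of_eqOn h.contDiffOn hξ (ContinuousLinearMap.id ℝ ℂ) j
    (fun _ hη => h.w_eq hη j) 0).1

theorem differentialC_w (h : c.HasSmoothRemainder f k) {ξ : Fin n → ℂ}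
    (hξ : ξ ∈ c.U) (j : Fin n) (V : TangentC n) :
    differentialC (c.w f j) ξ V = c.scale k j ξ * (V.1 j + V.2 j * Complex.I + ξ j *
      ∑ i, (c.smoothHessian k (c.moment ξ) j i : ℂ) * dyC ξ i V) := by
  simpa using (differentialC_of_eqOn h.contDiffOn hξ (ContinuousLinearMap.id ℝ ℂ) j
    (fun η hη => h.w_eq hη j) V).2

theorem differentialC_conj_w (h : c.HasSmoothRemainder f k) {ξ : Fin n → ℂ}
    (hξ : ξ ∈ c.U) (j : Fin n) (V : TangentC n) :
    differentialC (fun η => starRingEnd ℂ (c.w f j η)) ξ V =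
      c.scale k j ξ * (V.1 j - V.2 j * Complex.I + starRingEnd ℂ (ξ j) *
        ∑ i, (c.smoothHessian k (c.moment ξ) j i : ℂ) * dyC ξ i V) := by
  have := (differentialC_of_eqOn h.contDiffOn hξ
    (Complex.conjCLE : ℂ →L[ℝ] ℂ) j (F := fun η => starRingEnd ℂ (c.w f j η))
    (fun η hη => by rw [h.w_eq hη j]; simp) V).2
  rw [this]
  simp
  ring_nf
  simp

end HasSmoothRemainder

end DelzantPolytope.VertexChart
end

/-! ### Block matrices -/

noncomputable section

section LowerBlock

variable {n : ℕ}

/-- The inclusion of the last `n - p` coordinates. -/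
def lowerInclusion (n p : ℕ) : Matrix (Fin n) {q : Fin n // p ≤ (q : ℕ)} ℝ :=
  (1 : Matrix (Fin n) (Fin n) ℝ).submatrix id Subtype.val

theorem mul_lowerInclusion_apply {m : Type*} {p : ℕ} (M : Matrix m (Fin n) ℝ) (i : m)
    (q : {q : Fin n // p ≤ (q : ℕ)}) : (M * lowerInclusion n p) i q = M i q.1 := by
  simp [lowerInclusion, mul_apply, one_apply]

theorem lowerBlock_eq (p : ℕ) (M : Matrix (Fin n) (Fin n) ℝ) :
    lowerBlock p M = (lowerInclusion n p)ᵀ * M * lowerInclusion n p := by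
  ext q r
  rw [mul_lowerInclusion_apply]
  simp [lowerBlock, lowerInclusion, mul_apply, one_apply]

theorem diagZero_eq (p : ℕ) (E : Matrix {q : Fin n // p ≤ (q : ℕ)} {q : Fin n // p ≤ (q : ℕ)} ℝ) :
    diagZero p E = lowerInclusion n p * E * (lowerInclusion n p)ᵀ := by
  ext q r
  simp only [diagZero, of_apply, mul_apply, lowerInclusion, transpose_apply, submatrix_apply, id,
    one_apply, ite_mul, one_mul, zero_mul, mul_ite, mul_one, mul_zero]
  split_ifs with h
  · rw [Finset.sum_eq_single ⟨r, h.2⟩, if_pos rfl, Finset.sum_eq_single ⟨q, h.1⟩, if_pos rfl]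
    · exact fun b _ hb => if_neg fun h' => hb (Subtype.ext h'.symm)
    · simp
    · exact fun b _ hb => if_neg fun h' => hb (Subtype.ext h'.symm)
    · simp
  · refine (Finset.sum_eq_zero fun b _ => ?_).symm
    split_ifs with h₁
    · refine Finset.sum_eq_zero fun a _ => if_neg fun h₂ => h ?_
      exact ⟨h₂ ▸ a.2, h₁ ▸ b.2⟩
    · rfl

theorem lowerInclusion_transpose_mul_self (n p : ℕ) :
    (lowerInclusion n p)ᵀ * lowerInclusion n p = 1 := by
  ext q r
  rw [mul_lowerInclusion_apply]
  simp [lowerInclusion, one_apply, Subtype.ext_iff, eq_comm]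

end LowerBlock

/-! ### Frames of the Kähler polarization at points over a face -/

namespace DelzantPolytope.VertexChart

variable {n d : ℕ} {P : DelzantPolytope n d} {c : P.VertexChart} {f k : (Fin n → ℝ) → ℝ}
  {ξ : Fin n → ℂ}

/-- `R G R`, where `G` is the Hessian of `½ ∑ x_v^j log x_v^j + k` and `R = diag √(2 x_v^j)`, in
terms of the Hessian `S` of `k`; it is regular at the boundary. -/
def rescaled (ρ : Fin n → ℝ) (S : Matrix (Fin n) (Fin n) ℝ) : Matrix (Fin n) (Fin n) ℝ :=
  1 + diagonal ρ * S * diagonal ρ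

theorem conj_mul_self (z : ℂ) : starRingEnd ℂ z * z = (‖z‖ : ℂ) ^ 2 := by
  rw [mul_comm, Complex.mul_conj, Complex.normSq_eq_norm_sq]; push_cast; rfl

/-- This is `d|ξ_i|² = ξ̄_i dξ_i + ξ_i dξ̄_i`. -/
theorem two_mul_dyC (ξ : Fin n → ℂ) (i : Fin n) (V : TangentC n) :
    2 * dyC ξ i V = starRingEnd ℂ (ξ i) * (V.1 i + V.2 i * Complex.I) +
      ξ i * (V.1 i - V.2 i * Complex.I) := by
  obtain ⟨a, b⟩ := V
  simp only [dyC]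
  generalize ξ i = z
  have h₁ : z = (z.re : ℂ) + z.im * Complex.I := (Complex.re_add_im z).symm
  have h₂ : starRingEnd ℂ z = (z.re : ℂ) - z.im * Complex.I := by
    apply Complex.ext <;> simp
  generalize (z.re : ℂ) = x at *
  generalize (z.im : ℂ) = y at *
  rw [h₂, h₁]
  linear_combination 2 * b i * y * Complex.I_sq

/-- The differentials of `w_v^j` and their conjugates are linearly independent. -/
theorem HasSmoothRemainder.eq_zero_of_differentialC_eq_zero (h : c.HasSmoothRemainder f k)
    (hξ : ξ ∈ c.U)
    (hQ : (rescaled (fun j => ‖ξ j‖) (c.smoothHessian k (c.moment ξ))).det ≠ 0)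
    {V : TangentC n} (h₁ : ∀ j, differentialC (c.w f j) ξ V = 0)
    (h₂ : ∀ j, differentialC (fun η => starRingEnd ℂ (c.w f j η)) ξ V = 0) : V = 0 := by
  set S := c.smoothHessian k (c.moment ξ) with hS
  have hsc : ∀ j, (c.scale k j ξ : ℂ) ≠ 0 := fun j => by exact_mod_cast (scale_pos j ξ).ne'
  set τ : Fin n → ℂ := fun j => ∑ i, (S j i : ℂ) * dyC ξ i V with hτ
  have e₁ : ∀ j, V.1 j + V.2 j * Complex.I = -(ξ j * τ j) := fun j => by
    have := h₁ j
    rw [h.differentialC_w hξ, mul_eq_zero, or_iff_right (hsc j)] at this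
    exact eq_neg_of_add_eq_zero_left this
  have e₂ : ∀ j, V.1 j - V.2 j * Complex.I = -(starRingEnd ℂ (ξ j) * τ j) := fun j => by
    have := h₂ j
    rw [h.differentialC_conj_w hξ, mul_eq_zero, or_iff_right (hsc j)] at this
    exact eq_neg_of_add_eq_zero_left this
  have e₃ : ∀ i, dyC ξ i V = -((‖ξ i‖ : ℂ) ^ 2 * τ i) := fun i => by
    have := two_mul_dyC ξ i V
    rw [e₁, e₂] at this
    linear_combination this / 2 - τ i * conj_mul_self (ξ i)
  -- Inserting `e₃` into the definition of `τ` gives `τ = -S R² τ` with `R = diag |ξ_j|`. Multiplied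
  -- by `R` this is `(1 + R S R) R τ = 0`, and the matrix is invertible by `hQ`.
  have hτ0 : ∀ i, (‖ξ i‖ : ℂ) * τ i = 0 := by
    have hdet : ((rescaled (fun j => ‖ξ j‖) S).map Complex.ofRealHom).det ≠ 0 := by
      rw [← RingHom.mapMatrix_apply, ← RingHom.map_det]
      simpa using hQ
    refine congrFun (f := fun i => (‖ξ i‖ : ℂ) * τ i) (g := 0)
      (eq_zero_of_mulVec_eq_zero hdet ?_)
    ext j
    have e₄ : ∑ i, (S j i : ℂ) * ((‖ξ i‖ : ℂ) ^ 2 * τ i) = - τ j := by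
      rw [show τ j = ∑ i, (S j i : ℂ) * dyC ξ i V from rfl, ← Finset.sum_neg_distrib]
      exact Finset.sum_congr rfl fun i _ => by rw [e₃]; ring
    have e₅ : ∀ i, (rescaled (fun j => ‖ξ j‖) S).map Complex.ofRealHom j i =
        (if j = i then 1 else 0) + (‖ξ j‖ : ℂ) * S j i * ‖ξ i‖ := fun i => by
      by_cases hij : j = i
      · subst hij; simp [rescaled, diagonal_mul, mul_diagonal]
      · simp [rescaled, diagonal_mul, mul_diagonal, hij]
    simp only [mulVec, dotProduct, e₅, add_mul, Finset.sum_add_distrib, ite_mul, one_mul, zero_mul,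
      Finset.sum_ite_eq, Finset.mem_univ, if_true, Pi.zero_apply]
    have e₆ : ∑ i, (‖ξ j‖ : ℂ) * S j i * ‖ξ i‖ * (‖ξ i‖ * τ i) = -(‖ξ j‖ * τ j) := by
      rw [← mul_neg, ← e₄, Finset.mul_sum]
      exact Finset.sum_congr rfl fun i _ => by ring
    rw [e₆, add_neg_cancel]
  have hdy : ∀ i, dyC ξ i V = 0 := fun i => by
    rw [e₃, pow_two, mul_assoc, hτ0, mul_zero, neg_zero]
  have hτ1 : ∀ j, τ j = 0 := fun j => by simp [τ, hdy]
  have f₁ : ∀ j, V.1 j = 0 := fun j => by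
    have := e₁ j; have h' := e₂ j
    rw [hτ1] at this h'
    linear_combination (this + h') / 2
  have f₂ : ∀ j, V.2 j = 0 := fun j => by
    have := e₁ j
    rw [hτ1, f₁] at this
    simpa using this
  exact Prod.ext (funext f₁) (funext f₂)

/-- The `2n` forms `dw_v^j`, `dw̄_v^j` define an injective, hence bijective, map of the
`2n`-dimensional tangent space; take the dual vectors. -/
theorem HasSmoothRemainder.exists_isHolomorphicFrame (h : c.HasSmoothRemainder f k)
    (hξ : ξ ∈ c.U)
    (hQ : (rescaled (fun j => ‖ξ j‖) (c.smoothHessian k (c.moment ξ))).det ≠ 0) :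
    ∃ W, c.IsHolomorphicFrame f ξ W := by
  let Ψ : TangentC n →ₗ[ℂ] (Fin n → ℂ) × (Fin n → ℂ) :=
    (LinearMap.pi fun j => differentialC (c.w f j) ξ).prod
      (LinearMap.pi fun j => differentialC (fun η => starRingEnd ℂ (c.w f j η)) ξ)
  have hΨ : Function.Injective Ψ := by
    refine (injective_iff_map_eq_zero Ψ).2 fun V hV => ?_
    have hV' := Prod.mk.inj hV
    exact h.eq_zero_of_differentialC_eq_zero hξ hQ (fun j => congrFun hV'.1 j)
      (fun j => congrFun hV'.2 j)
  have hsurj : Function.Surjective Ψ := LinearMap.injective_iff_surjective.1 hΨ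
  choose W hW using fun j : Fin n => hsurj (Pi.single j 1, 0)
  refine ⟨W, fun j => h.differentiableAt_w hξ j, fun j i => ?_⟩
  have hV' := Prod.mk.inj (hW j)
  refine ⟨?_, congrFun hV'.2 i⟩
  have := congrFun hV'.1 i
  simpa [Pi.single_apply, eq_comm] using this

/-- The vector `2 ∂/∂ξ_j = ∂/∂u_j - i ∂/∂v_j`. -/
def holoVector (j : Fin n) : TangentC n := (Pi.single j 1, Pi.single j (-Complex.I))

theorem dyC_holoVector {j : Fin n} (hj : ξ j = 0) (i : Fin n) : dyC ξ i (holoVector j) = 0 := by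
  by_cases hij : i = j
  · subst hij; simp [dyC, hj]
  · simp [dyC, holoVector, hij]

/-- Where `ξ_j = 0`, every `dy_i` kills `∂/∂ξ_j`, so the potential enters `dw_v^i (∂/∂ξ_j)` only
through the factor `scale`. This is why the span of the `∂/∂w_v^j` along a face does not depend on
the potential. -/
theorem HasSmoothRemainder.eq_smul_holoVector (h : c.HasSmoothRemainder f k) (hξ : ξ ∈ c.U)
    (hQ : (rescaled (fun j => ‖ξ j‖) (c.smoothHessian k (c.moment ξ))).det ≠ 0)
    {W : Fin n → TangentC n} (hW : c.IsHolomorphicFrame f ξ W) {j : Fin n} (hj : ξ j = 0) :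
    ∃ a : ℂ, a ≠ 0 ∧ W j = a • holoVector j := by
  have hsc : ∀ j, (c.scale k j ξ : ℂ) ≠ 0 := fun j => by exact_mod_cast (scale_pos j ξ).ne'
  refine ⟨(2 * (c.scale k j ξ : ℂ))⁻¹, inv_ne_zero (mul_ne_zero two_ne_zero (hsc j)), ?_⟩
  rw [← sub_eq_zero]
  refine h.eq_zero_of_differentialC_eq_zero hξ hQ (fun i => ?_) fun i => ?_
  · rw [map_sub, map_smul, (hW.2 j i).1, h.differentialC_w hξ]
    simp only [dyC_holoVector hj, mul_zero, Finset.sum_const_zero, add_zero]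
    by_cases hij : j = i
    · subst hij
      simp only [holoVector, Pi.single_eq_same, if_true, smul_eq_mul]
      have := hsc j
      field_simp
      linear_combination Complex.I_sq
    · simp [holoVector, hij]
  · rw [map_sub, map_smul, (hW.2 j i).2, h.differentialC_conj_w hξ]
    simp only [dyC_holoVector hj, mul_zero, Finset.sum_const_zero, add_zero]
    by_cases hij : j = i
    · subst hij
      simp [holoVector]
    · simp [holoVector, hij]

variable {I : Finset (Fin n)}

theorem dx_eq_zero {i : Fin n} (hi : ξ i = 0) : c.dx ξ i = 0 := by
  simp [dx, hi]

/-- With division by zero equal to zero, `c.dx ξ i` is the zero vector when `ξ i = 0`, so the sum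
may run over all indices. -/
theorem mixedVector_eq_sum (hI : ∀ i, i ∈ I ↔ ξ i = 0) (M : Matrix (Fin n) (Fin n) ℝ) (j : Fin n) :
    c.mixedVector ξ I M j = (∑ i, (M j i : ℂ) • c.dx ξ i) - Complex.I • c.dθ ξ j := by
  rw [mixedVector, Finset.sum_subset (Finset.subset_univ Iᶜ)]
  intro i _ hi
  rw [Finset.mem_compl, not_not] at hi
  rw [dx_eq_zero ((hI i).1 hi), smul_zero]

theorem mixedVector_fst (hI : ∀ i, i ∈ I ↔ ξ i = 0) (M : Matrix (Fin n) (Fin n) ℝ)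
    (j m : Fin n) : (c.mixedVector ξ I M j).1 m =
      (M j m : ℂ) * (((ξ m).re : ℂ) / (‖ξ m‖ : ℂ) ^ 2) +
        Complex.I * (if j = m then ((ξ m).im : ℂ) else 0) := by
  rw [mixedVector_eq_sum hI]
  by_cases hjm : j = m
  · subst hjm
    simp [Prod.fst_sum, dx, dθ, Pi.single_apply]
  · simp [Prod.fst_sum, dx, dθ, Pi.single_apply, hjm, Ne.symm hjm]

theorem mixedVector_snd (hI : ∀ i, i ∈ I ↔ ξ i = 0) (M : Matrix (Fin n) (Fin n) ℝ)
    (j m : Fin n) : (c.mixedVector ξ I M j).2 m =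
      (M j m : ℂ) * (((ξ m).im : ℂ) / (‖ξ m‖ : ℂ) ^ 2) -
        Complex.I * (if j = m then ((ξ m).re : ℂ) else 0) := by
  rw [mixedVector_eq_sum hI]
  by_cases hjm : j = m
  · subst hjm
    simp [Prod.snd_sum, dx, dθ, Pi.single_apply]
  · simp [Prod.snd_sum, dx, dθ, Pi.single_apply, hjm, Ne.symm hjm]

theorem dyC_mixedVector (hI : ∀ i, i ∈ I ↔ ξ i = 0) {M : Matrix (Fin n) (Fin n) ℝ}
    (hM : ∀ i ∈ I, ∀ j, M j i = 0) (j m : Fin n) :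
    dyC ξ m (c.mixedVector ξ I M j) = M j m := by
  rw [dyC, mixedVector_fst hI, mixedVector_snd hI]
  by_cases hm : ξ m = 0
  · simp [hM m ((hI m).2 hm) j, hm]
  · have h₁ : (‖ξ m‖ : ℂ) ≠ 0 := by exact_mod_cast (norm_pos_iff.2 hm).ne'
    have h₂ : ((ξ m).re : ℂ) ^ 2 + ((ξ m).im : ℂ) ^ 2 = (‖ξ m‖ : ℂ) ^ 2 := by
      rw [← Complex.ofReal_pow ‖ξ m‖, ← Complex.normSq_eq_norm_sq, Complex.normSq_apply]
      push_cast; ring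
    have h₃ : ((ξ m).re : ℂ) / (‖ξ m‖ : ℂ) ^ 2 * (ξ m).re +
        ((ξ m).im : ℂ) / (‖ξ m‖ : ℂ) ^ 2 * (ξ m).im = 1 := by
      rw [div_mul_eq_mul_div, div_mul_eq_mul_div, ← add_div, div_eq_one_iff_eq (pow_ne_zero 2 h₁),
        ← h₂]
      ring
    split_ifs
    · linear_combination (M j m : ℂ) * h₃
    · linear_combination (M j m : ℂ) * h₃

/-- With `R = diag |ξ_j|`, `hMS` reads `M (1 + S R²) = R²`: it is `M G = 1` for `G = R⁻² + S`,
multiplied by `R²` so as to make sense where `R` is singular. Its `(j, l)` entry is what the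
vanishing of `dw̄_v^l` requires when `ξ_l ≠ 0`; if `ξ_l = 0` every term is zero. -/
theorem HasSmoothRemainder.differentialC_conj_w_mixedVector (h : c.HasSmoothRemainder f k)
    (hξ : ξ ∈ c.U) (hI : ∀ i, i ∈ I ↔ ξ i = 0) {M : Matrix (Fin n) (Fin n) ℝ}
    (hM : ∀ i ∈ I, ∀ j, M j i = 0) (hS : (c.smoothHessian k (c.moment ξ))ᵀ =
      c.smoothHessian k (c.moment ξ))
    (hMS : M + M * c.smoothHessian k (c.moment ξ) * diagonal (fun j => ‖ξ j‖ ^ 2) =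
      diagonal (fun j => ‖ξ j‖ ^ 2)) (j l : Fin n) :
    differentialC (fun η => starRingEnd ℂ (c.w f l η)) ξ (c.mixedVector ξ I M j) = 0 := by
  rw [h.differentialC_conj_w hξ, mul_eq_zero]
  right
  by_cases hl : ξ l = 0
  · simp [mixedVector_fst hI, mixedVector_snd hI, hl]
  · have hnorm : (‖ξ l‖ : ℂ) ≠ 0 := by exact_mod_cast (norm_pos_iff.2 hl).ne'
    set S := c.smoothHessian k (c.moment ξ)
    have h₁ : ∑ i, (S l i : ℂ) * dyC ξ i (c.mixedVector ξ I M j) = ((M * S) j l : ℝ) := by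
      rw [mul_apply]
      push_cast
      refine Finset.sum_congr rfl fun i _ => ?_
      have : S l i = S i l := by
        conv_rhs => rw [← hS]
        rfl
      rw [dyC_mixedVector hI hM, this, mul_comm]
    have h₂ : (M j l : ℂ) + ((M * S) j l : ℝ) * (‖ξ l‖ : ℂ) ^ 2 =
        if j = l then (‖ξ l‖ : ℂ) ^ 2 else 0 := by
      have := congrFun (congrFun hMS j) l
      rw [Matrix.add_apply, mul_diagonal, diagonal_apply] at this
      rw [← Complex.ofReal_pow, ← Complex.ofReal_mul, ← Complex.ofReal_add, this]
      split_ifs with hjl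
      · rw [hjl]
      · simp
    have h₃ : starRingEnd ℂ (ξ l) = ((ξ l).re : ℂ) - (ξ l).im * Complex.I := by
      apply Complex.ext <;> simp
    rw [h₁, mixedVector_fst hI, mixedVector_snd hI, h₃]
    have h₄ : (((M * S) j l : ℝ) : ℂ) = ((if j = l then (‖ξ l‖ : ℂ) ^ 2 else 0) - (M j l : ℂ)) /
        (‖ξ l‖ : ℂ) ^ 2 := by
      rw [eq_div_iff (pow_ne_zero 2 hnorm)]
      linear_combination h₂
    rw [h₄]
    split_ifs
    · field_simp
      linear_combination ((ξ l).re : ℂ) * (‖ξ l‖ : ℂ) ^ 2 * Complex.I_sq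
    · field_simp
      ring

/-- The vectors `W_j`, `j ∈ I`, and `∑_k M_{jk} ∂/∂x_v^k - i ∂/∂θ_v^j`, `j ∉ I`. -/
def frame (c : P.VertexChart) (ξ : Fin n → ℂ) (I : Finset (Fin n)) (W : Fin n → TangentC n)
    (M : Matrix (Fin n) (Fin n) ℝ) (j : Fin n) : TangentC n :=
  if j ∈ I then W j else c.mixedVector ξ I M j

/-- No condition on `M` is needed, so independence persists in the limit `s → ∞`: the `∂/∂θ_v^j`
components detect the coefficients outside `I`, and the remaining vectors lie in different
coordinate planes. -/
theorem linearIndependent_frame (hI : ∀ i, i ∈ I ↔ ξ i = 0) {W : Fin n → TangentC n}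
    (hW : ∀ j ∈ I, ∃ a : ℂ, a ≠ 0 ∧ W j = a • holoVector j) (M : Matrix (Fin n) (Fin n) ℝ) :
    LinearIndependent ℂ (c.frame ξ I W M) := by
  rw [Fintype.linearIndependent_iff]
  intro g hg
  have h₁ : ∀ l, ∑ j, g j * (c.frame ξ I W M j).1 l = 0 := fun l => by
    have := congrFun (congrArg Prod.fst hg) l
    simpa [Prod.fst_sum, Finset.sum_apply] using this
  have h₂ : ∀ l, ∑ j, g j * (c.frame ξ I W M j).2 l = 0 := fun l => by
    have := congrFun (congrArg Prod.snd hg) l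
    simpa [Prod.snd_sum, Finset.sum_apply] using this
  have hout : ∀ l, l ∉ I → g l = 0 := by
    intro l hl
    have hl0 : ξ l ≠ 0 := fun h => hl ((hI l).2 h)
    -- Apply the form `-v_l du_l + u_l dv_l`: it annihilates `∂/∂x_v^l` and takes the value `|ξ_l|²`
    -- on `∂/∂θ_v^l`.
    have h₃ : ∑ j, g j * (-((ξ l).im : ℂ) * (c.frame ξ I W M j).1 l +
        (ξ l).re * (c.frame ξ I W M j).2 l) = 0 := by
      have e : ∑ j, g j * (-((ξ l).im : ℂ) * (c.frame ξ I W M j).1 l +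
        (ξ l).re * (c.frame ξ I W M j).2 l) =
        -((ξ l).im : ℂ) * ∑ j, g j * (c.frame ξ I W M j).1 l +
          (ξ l).re * ∑ j, g j * (c.frame ξ I W M j).2 l := by
        rw [Finset.mul_sum, Finset.mul_sum, ← Finset.sum_add_distrib]
        exact Finset.sum_congr rfl fun j _ => by ring
      rw [e, h₁, h₂]; simp
    rw [Finset.sum_eq_single l] at h₃
    · rw [frame, if_neg hl, mixedVector_fst hI, mixedVector_snd hI, mul_eq_zero] at h₃
      refine h₃.resolve_right fun h₄ => hl0 ?_
      simp only [if_true] at h₄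
      have h₅ : -Complex.I * (((ξ l).im ^ 2 + (ξ l).re ^ 2 : ℝ) : ℂ) = 0 := by
        push_cast
        linear_combination h₄
      rw [mul_eq_zero, or_iff_right (neg_ne_zero.2 Complex.I_ne_zero), Complex.ofReal_eq_zero] at h₅
      apply Complex.ext
      · simp only [Complex.zero_re]; nlinarith [sq_nonneg (ξ l).im, sq_nonneg (ξ l).re]
      · simp only [Complex.zero_im]; nlinarith [sq_nonneg (ξ l).im, sq_nonneg (ξ l).re]
    · intro j _ hjl
      by_cases hj : j ∈ I
      · obtain ⟨a, -, ha⟩ := hW j hj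
        simp [frame, hj, ha, holoVector, hjl.symm]
      · rw [frame, if_neg hj, mixedVector_fst hI, mixedVector_snd hI, if_neg hjl, if_neg hjl]
        ring
    · simp
  intro l
  by_cases hl : l ∈ I
  · have h₃ := h₁ l
    obtain ⟨a, ha0, ha⟩ := hW l hl
    rw [Finset.sum_eq_single l] at h₃
    · rw [frame, if_pos hl, ha, mul_eq_zero] at h₃
      refine h₃.resolve_right ?_
      simpa [holoVector] using ha0
    · intro j _ hjl
      by_cases hj : j ∈ I
      · obtain ⟨b, -, hb⟩ := hW j hj
        simp [frame, hj, hb, holoVector, hjl.symm]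
      · rw [hout j hj, zero_mul]
    · simp
  · exact hout l hl

theorem frame_image_mem (W : Fin n → TangentC n) (M : Matrix (Fin n) (Fin n) ℝ) :
    c.frame ξ I W M '' {j | j ∈ I} = W '' {j | j ∈ I} :=
  Set.image_congr fun _ hj => if_pos hj

theorem frame_image_not_mem (W : Fin n → TangentC n) (M : Matrix (Fin n) (Fin n) ℝ) :
    c.frame ξ I W M '' {j | j ∉ I} = c.mixedVector ξ I M '' {j | j ∉ I} :=
  Set.image_congr fun _ hj => if_neg hj

theorem span_range_frame (W : Fin n → TangentC n) (M : Matrix (Fin n) (Fin n) ℝ) :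
    Submodule.span ℂ (Set.range (c.frame ξ I W M)) =
      Submodule.span ℂ (W '' {j | j ∈ I}) ⊔
        Submodule.span ℂ (c.mixedVector ξ I M '' {j | j ∉ I}) := by
  rw [← frame_image_mem (c := c) (ξ := ξ) W M, ← frame_image_not_mem W M, ← Submodule.span_union,
    ← Set.image_union, ← Set.image_univ]
  congr 2
  ext j
  simp [em]

theorem disjoint_span_frame (hI : ∀ i, i ∈ I ↔ ξ i = 0) {W : Fin n → TangentC n}
    (hW : ∀ j ∈ I, ∃ a : ℂ, a ≠ 0 ∧ W j = a • holoVector j) (M : Matrix (Fin n) (Fin n) ℝ) :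
    Disjoint (Submodule.span ℂ (W '' {j | j ∈ I}))
      (Submodule.span ℂ (c.mixedVector ξ I M '' {j | j ∉ I})) := by
  rw [← frame_image_mem (c := c) (ξ := ξ) W M, ← frame_image_not_mem W M]
  refine (linearIndependent_frame hI hW M).disjoint_span_image ?_
  exact Set.disjoint_left.2 fun j hj hj' => hj' hj

theorem continuous_frame (W : Fin n → TangentC n) : Continuous (c.frame ξ I W) := by
  refine continuous_pi fun j => ?_
  by_cases hj : j ∈ I
  · simp only [frame, if_pos hj]
    exact continuous_const
  · simp only [frame, if_neg hj, mixedVector]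
    refine (continuous_finsetSum _ fun i _ => ?_).sub continuous_const
    exact (Complex.continuous_ofReal.comp (continuous_apply_apply j i)).smul continuous_const

/-- The frame lies in the polarization and spans dimension `n`; the polarization has dimension at
most `n` because the `dw_v^j` are jointly injective on it. -/
theorem HasSmoothRemainder.kahlerPolarization_eq_span (h : c.HasSmoothRemainder f k)
    (hξ : ξ ∈ c.U) (hI : ∀ i, i ∈ I ↔ ξ i = 0)
    (hQ : (rescaled (fun j => ‖ξ j‖) (c.smoothHessian k (c.moment ξ))).det ≠ 0)
    {W : Fin n → TangentC n}
    (hW : ∀ j ∈ I, ∃ a : ℂ, a ≠ 0 ∧ W j = a • holoVector j)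
    {M : Matrix (Fin n) (Fin n) ℝ}
    (hM : ∀ i ∈ I, ∀ j, M j i = 0) (hS : (c.smoothHessian k (c.moment ξ))ᵀ =
      c.smoothHessian k (c.moment ξ))
    (hMS : M + M * c.smoothHessian k (c.moment ξ) * diagonal (fun j => ‖ξ j‖ ^ 2) =
      diagonal (fun j => ‖ξ j‖ ^ 2)) :
    c.kahlerPolarization f ξ = Submodule.span ℂ (Set.range (c.frame ξ I W M)) := by
  symm
  refine Submodule.eq_of_le_of_finrank_le ?_ ?_
  · rw [Submodule.span_le]
    rintro _ ⟨j, rfl⟩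
    simp only [kahlerPolarization, SetLike.mem_coe, Submodule.mem_iInf, LinearMap.mem_ker]
    intro l
    by_cases hj : j ∈ I
    · obtain ⟨a, -, ha⟩ := hW j hj
      rw [frame, if_pos hj, ha, map_smul, h.differentialC_conj_w hξ]
      simp only [dyC_holoVector ((hI j).1 hj), mul_zero, Finset.sum_const_zero, add_zero]
      by_cases hjl : j = l
      · subst hjl; simp [holoVector]
      · simp [holoVector, hjl]
    · rw [frame, if_neg hj]
      exact h.differentialC_conj_w_mixedVector hξ hI hM hS hMS j l
  · rw [finrank_span_eq_card (linearIndependent_frame hI hW M), Fintype.card_fin]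
    let Φ : c.kahlerPolarization f ξ →ₗ[ℂ] (Fin n → ℂ) :=
      (LinearMap.pi fun j => differentialC (c.w f j) ξ) ∘ₗ (c.kahlerPolarization f ξ).subtype
    have hΦ : Function.Injective Φ := by
      refine (injective_iff_map_eq_zero Φ).2 fun V hV => ?_
      have hV₂ := V.2
      simp only [kahlerPolarization, Submodule.mem_iInf, LinearMap.mem_ker] at hV₂
      exact Subtype.ext (h.eq_zero_of_differentialC_eq_zero hξ hQ (fun j => congrFun hV j) hV₂)
    simpa using LinearMap.finrank_le_finrank_of_injective hΦ

theorem limitVector_eq_mixedVector (B : SpecialLinearGroup (Fin n) ℤ) (p : ℕ)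
    (E : Matrix {q : Fin n // p ≤ (q : ℕ)} {q : Fin n // p ≤ (q : ℕ)} ℝ) (j : Fin n) :
    limitVector c B p ξ I E j =
      c.mixedVector ξ I (c.Atilde B * diagZero p E * (c.Atilde B)ᵀ) j := by
  rw [limitVector, mixedVector]
  congr 1
  have hsum : ∀ i, ∑ q, ∑ l, c.Atilde B j q.1 * E q l * c.Atilde B i l.1 =
      (c.Atilde B * diagZero p E * (c.Atilde B)ᵀ) j i := by
    intro i
    rw [diagZero_eq, ← Matrix.mul_assoc, ← Matrix.mul_assoc, Matrix.mul_assoc _ _ (c.Atilde B)ᵀ,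
      ← transpose_mul, mul_apply, Finset.sum_comm]
    simp_rw [mul_apply (M := c.Atilde B * lowerInclusion n p), Finset.sum_mul, transpose_apply,
      mul_lowerInclusion_apply]
  simp only [dxtilde, Finset.smul_sum, smul_smul]
  rw [Finset.sum_congr rfl fun q _ => Finset.sum_comm, Finset.sum_comm]
  refine Finset.sum_congr rfl fun i _ => ?_
  rw [← hsum]
  push_cast
  simp only [Finset.sum_smul]

end DelzantPolytope.VertexChart
end

/-! ### Hessians in linear coordinates, and the compression in the interior -/

noncomputable section

section Hessian

variable {n : ℕ} {f₁ f₂ : (Fin n → ℝ) → ℝ} {x : Fin n → ℝ}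

theorem fderiv_fderiv_apply (hf : ContDiffAt ℝ 2 f₁ x) (v w : Fin n → ℝ) :
    fderiv ℝ (fun y => fderiv ℝ f₁ y v) x w = fderiv ℝ (fderiv ℝ f₁) x w v := by
  have h₁ : DifferentiableAt ℝ (fderiv ℝ f₁) x :=
    (hf.fderiv_right (m := 1) (by norm_num)).differentiableAt (by simp)
  rw [fderiv_clm_apply h₁ (differentiableAt_const v)]
  simp

theorem hessianIn_mul (hf : ContDiffAt ℝ 2 f₁ x) (C K : Matrix (Fin n) (Fin n) ℝ) :
    hessianIn (C * K) f₁ x = Kᵀ * hessianIn C f₁ x * K := by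
  ext i j
  have hcol : ∀ i, (C * K) *ᵥ Pi.single i 1 = ∑ k, K k i • (C *ᵥ Pi.single k 1) := fun i => by
    ext m
    simp [mul_apply, mul_comm]
  simp only [hessianIn, of_apply, fderiv_fderiv_apply hf, mul_apply, transpose_apply]
  simp only [hcol, map_sum, map_smul, _root_.sum_apply, _root_.smul_apply, smul_eq_mul, Finset.sum_mul,
    Finset.mul_sum]
  rw [Finset.sum_comm]
  refine Finset.sum_congr rfl fun k _ => Finset.sum_congr rfl fun m _ => by ring

theorem hessianIn_add_smul (h₁ : ContDiffAt ℝ 2 f₁ x) (h₂ : ContDiffAt ℝ 2 f₂ x) (s : ℝ)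
    (C : Matrix (Fin n) (Fin n) ℝ) :
    hessianIn C (fun y => f₁ y + s * f₂ y) x = hessianIn C f₁ x + s • hessianIn C f₂ x := by
  have hd : fderiv ℝ (fun y => f₁ y + s * f₂ y) =ᶠ[𝓝 x]
      fun y => fderiv ℝ f₁ y + s • fderiv ℝ f₂ y := by
    filter_upwards [h₁.eventually (by simp), h₂.eventually (by simp)] with y hy₁ hy₂
    have d₁ := hy₁.differentiableAt (by simp)
    have d₂ := hy₂.differentiableAt (by simp)
    rw [fderiv_fun_add d₁ (d₂.const_mul s), fderiv_const_mul d₂]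
  have e₁ : DifferentiableAt ℝ (fderiv ℝ f₁) x :=
    (h₁.fderiv_right (m := 1) (by norm_num)).differentiableAt (by simp)
  have e₂ : DifferentiableAt ℝ (fderiv ℝ f₂) x :=
    (h₂.fderiv_right (m := 1) (by norm_num)).differentiableAt (by simp)
  have h₃ : ContDiffAt ℝ 2 (fun y => f₁ y + s * f₂ y) x := h₁.add (contDiffAt_const.mul h₂)
  ext i j
  simp only [hessianIn, Matrix.add_apply, Matrix.smul_apply, of_apply, fderiv_fderiv_apply h₁,
    fderiv_fderiv_apply h₂, fderiv_fderiv_apply h₃]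
  rw [hd.fderiv_eq, fderiv_fun_add e₁ (e₂.fun_const_smul s), fderiv_fun_const_smul e₂]
  simp

/-- The matrix `B` with real entries. -/
def realMatrix (B : SpecialLinearGroup (Fin n) ℤ) : Matrix (Fin n) (Fin n) ℝ :=
  (B : Matrix (Fin n) (Fin n) ℤ).map (Int.cast : ℤ → ℝ)

theorem det_realMatrix (B : SpecialLinearGroup (Fin n) ℤ) : (realMatrix B).det = 1 := by
  have h : realMatrix B = (Int.castRingHom ℝ).mapMatrix (B : Matrix (Fin n) (Fin n) ℤ) := rfl
  rw [h, ← RingHom.map_det, B.det_coe, map_one]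

/-- The projection to the first `p` coordinates. -/
def upperProjection (n p : ℕ) : Matrix (Fin n) (Fin n) ℝ :=
  1 - lowerInclusion n p * (lowerInclusion n p)ᵀ

theorem upperProjection_eq (n p : ℕ) :
    upperProjection n p = diagonal fun j : Fin n => if (j : ℕ) < p then 1 else 0 := by
  have h := diagZero_eq (n := n) p 1
  rw [Matrix.mul_one] at h
  rw [upperProjection, ← h]
  ext i j
  by_cases hij : i = j
  · subst hij
    by_cases hi : p ≤ (i : ℕ)
    · simp [diagZero, hi, not_lt.2 hi]
    · simp [diagZero, hi, not_le.1 hi]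
  · simp [diagZero, hij, one_apply]

theorem upperProjection_transpose_mul_self (n p : ℕ) :
    (upperProjection n p)ᵀ * upperProjection n p = upperProjection n p := by
  simp [upperProjection_eq, diagonal_mul_diagonal]

theorem upperProjection_mul_lowerInclusion (n p : ℕ) :
    upperProjection n p * lowerInclusion n p = 0 := by
  rw [upperProjection, Matrix.sub_mul, Matrix.one_mul, Matrix.mul_assoc, lowerInclusion_transpose_mul_self,
    Matrix.mul_one, sub_self]

theorem hamiltonian_eq (B : SpecialLinearGroup (Fin n) ℤ) (p : ℕ) (x : Fin n → ℝ) :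
    hamiltonian B p x =
      1 / 2 * ∑ j : Fin n, (if (j : ℕ) < p then 1 else 0) * ((realMatrix B *ᵥ x) j) ^ 2 := by
  simp only [hamiltonian, ite_mul, one_mul, zero_mul]
  rw [← Finset.sum_filter, ← Finset.sum_subtype_eq_sum_filter]
  simp only [Finset.subtype_univ]
  rfl

theorem contDiff_hamiltonian (B : SpecialLinearGroup (Fin n) ℤ) (p : ℕ) :
    ContDiff ℝ ∞ (hamiltonian B p) := by
  have : hamiltonian B p = fun x =>
      1 / 2 * ∑ j : Fin n, (if (j : ℕ) < p then 1 else 0) * ((realMatrix B *ᵥ x) j) ^ 2 :=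
    funext (hamiltonian_eq B p)
  rw [this]
  refine contDiff_const.mul (.sum fun j _ => contDiff_const.mul (.pow ?_ 2))
  exact (LinearMap.toContinuousLinearMap
    (LinearMap.proj j ∘ₗ (realMatrix B).mulVecLin)).contDiff

theorem hessianIn_hamiltonian (B : SpecialLinearGroup (Fin n) ℤ) (p : ℕ)
    (C : Matrix (Fin n) (Fin n) ℝ) (x : Fin n → ℝ) :
    hessianIn C (hamiltonian B p) x =
      (realMatrix B * C)ᵀ * upperProjection n p * (realMatrix B * C) := by
  set ℓ : Fin n → (Fin n → ℝ) →L[ℝ] ℝ := fun j => LinearMap.toContinuousLinearMap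
    (LinearMap.proj j ∘ₗ (realMatrix B).mulVecLin) with hℓ
  have hℓa : ∀ j v, ℓ j v = (realMatrix B *ᵥ v) j := fun j v => rfl
  set ε : Fin n → ℝ := fun j => if (j : ℕ) < p then 1 else 0 with hε
  have hH : hamiltonian B p = fun x => 1 / 2 * ∑ j, ε j * ℓ j x ^ 2 :=
    funext (hamiltonian_eq B p)
  have hd : ∀ v y, fderiv ℝ (hamiltonian B p) y v = ∑ j, (ε j * ℓ j v) * ℓ j y := by
    intro v y
    have h₀ : ∀ j, HasFDerivAt (fun x => ε j * ℓ j x ^ 2) (ε j • ((2 * ℓ j y) • ℓ j)) y :=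
      fun j => HasFDerivAt.const_mul
        (by simpa [Function.comp_def] using
          (hasDerivAt_pow 2 (ℓ j y)).comp_hasFDerivAt y (ℓ j).hasFDerivAt) (ε j)
    have h₁ := (HasFDerivAt.fun_sum fun j (_ : j ∈ Finset.univ) => h₀ j).const_mul (1 / 2 : ℝ)
    rw [hH, h₁.fderiv]
    simp only [_root_.smul_apply, _root_.sum_apply, smul_eq_mul, Finset.mul_sum]
    refine Finset.sum_congr rfl fun j _ => ?_
    simp
    ring
  ext i m
  simp only [hessianIn, of_apply, hd]
  have h₃ := HasFDerivAt.fun_sum fun j (_ : j ∈ Finset.univ) =>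
      (((ℓ j).hasFDerivAt (x := x))).const_mul (ε j * ℓ j (C *ᵥ Pi.single i 1))
  rw [h₃.fderiv, upperProjection_eq, mul_apply]
  simp only [_root_.smul_apply, _root_.sum_apply, smul_eq_mul, hℓa, mulVec_mulVec, mul_diagonal,
    transpose_apply]
  refine Finset.sum_congr rfl fun j _ => ?_
  simp [hε]

end Hessian

section Compression

variable {n p : ℕ}

theorem diagonal_mul_diagonal_inv {ρ : Fin n → ℝ} (hρ : ∀ j, ρ j ≠ 0) :
    diagonal ρ * diagonal ρ⁻¹ = 1 := by
  rw [diagonal_mul_diagonal, ← diagonal_one]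
  congr 1
  ext j
  simp [hρ j]

theorem diagonal_inv_mul_diagonal {ρ : Fin n → ℝ} (hρ : ∀ j, ρ j ≠ 0) :
    diagonal ρ⁻¹ * diagonal ρ = 1 := by
  rw [diagonal_mul_diagonal, ← diagonal_one]
  congr 1
  ext j
  simp [hρ j]

theorem posDef_transpose_mul_mul {m : Type*} [Fintype m] [DecidableEq m]
    {G : Matrix (Fin n) (Fin n) ℝ} (hG : G.PosDef) {C : Matrix (Fin n) m ℝ}
    {L : Matrix m (Fin n) ℝ} (hL : L * C = 1) : (Cᵀ * G * C).PosDef := by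
  have hinj : Function.Injective C.mulVec := fun v w hvw => by
    have := congrArg (L *ᵥ ·) hvw
    simpa [mulVec_mulVec, hL] using this
  have := hG.conjTranspose_mul_mul_same hinj
  rwa [conjTranspose_eq_transpose_of_trivial] at this

/-- The compression of the inverse of `G` to the last `n - p` coordinates, in the frame given by
`V`. -/
theorem isCompressedInverse_of_posDef {G V : Matrix (Fin n) (Fin n) ℝ} (hG : G.PosDef)
    (hV : IsUnit V.det) {ρ : Fin n → ℝ} (hρ : ∀ j, ρ j ≠ 0)
    {Θ : Matrix (Fin n) (Fin n) ℝ}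
    (hΘ : Θ = diagonal ρ⁻¹ * (V * diagZero p (lowerBlock p (Vᵀ * G * V))⁻¹ * Vᵀ) * diagonal ρ⁻¹) :
    Θᵀ = Θ ∧ Θ * (diagonal ρ * G * diagonal ρ) * Θ = Θ ∧
      IsCompressedInverse ρ (diagonal ρ * G * diagonal ρ) (upperProjection n p * V⁻¹) Θ := by
  set K := lowerInclusion n p
  set C := V * K with hC
  set D := lowerBlock p (Vᵀ * G * V) with hDdef
  have hD : D = Cᵀ * G * C := by
    rw [hDdef, lowerBlock_eq, hC, transpose_mul]
    simp only [Matrix.mul_assoc]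
    rfl
  have hDpd : D.PosDef := by
    rw [hD]
    refine posDef_transpose_mul_mul hG (L := Kᵀ * V⁻¹) ?_
    rw [hC, Matrix.mul_assoc, ← Matrix.mul_assoc V⁻¹, nonsing_inv_mul _ hV, Matrix.one_mul]
    exact lowerInclusion_transpose_mul_self n p
  have hDdet : IsUnit D.det := (Matrix.isUnit_iff_isUnit_det _).1 hDpd.isUnit
  have hDt : D⁻¹ᵀ = D⁻¹ :=
    (conjTranspose_eq_transpose_of_trivial D⁻¹).symm.trans hDpd.inv.1
  have hΘ' : Θ = diagonal ρ⁻¹ * C * D⁻¹ * (Cᵀ * diagonal ρ⁻¹) := by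
    rw [hΘ, diagZero_eq, hC, transpose_mul]
    simp only [Matrix.mul_assoc]
    rfl
  have r₁ := diagonal_mul_diagonal_inv hρ
  have r₂ := diagonal_inv_mul_diagonal hρ
  -- The columns of `C` span the kernel of `upperProjection n p * V⁻¹`, and `D = Cᵀ G C`. This
  -- identity is `D D⁻¹ = 1` in disguise; it yields both `Θ Q Θ = Θ` and the reproduction of test
  -- vectors.
  have key : (Cᵀ * diagonal ρ⁻¹) * ((diagonal ρ * G * diagonal ρ) * Θ) = Cᵀ * diagonal ρ⁻¹ := by
    calc (Cᵀ * diagonal ρ⁻¹) * ((diagonal ρ * G * diagonal ρ) * Θ)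
        = Cᵀ * (diagonal ρ⁻¹ * diagonal ρ) * G * (diagonal ρ * diagonal ρ⁻¹) * C * D⁻¹ *
            (Cᵀ * diagonal ρ⁻¹) := by rw [hΘ']; simp only [Matrix.mul_assoc]
      _ = Cᵀ * diagonal ρ⁻¹ := by
        rw [r₁, r₂, Matrix.mul_one, Matrix.mul_one, ← hD, mul_nonsing_inv _ hDdet, Matrix.one_mul]
  refine ⟨?_, ?_, ?_, ?_⟩
  · rw [hΘ']
    simp only [transpose_mul, transpose_transpose, diagonal_transpose, hDt, Matrix.mul_assoc]
  · rw [Matrix.mul_assoc]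
    nth_rewrite 1 [hΘ']
    rw [Matrix.mul_assoc, key, ← hΘ']
  · rw [hΘ']
    calc upperProjection n p * V⁻¹ * diagonal ρ * (diagonal ρ⁻¹ * C * D⁻¹ * (Cᵀ * diagonal ρ⁻¹))
        = upperProjection n p * V⁻¹ * (diagonal ρ * diagonal ρ⁻¹) * V * K * D⁻¹ *
            (Cᵀ * diagonal ρ⁻¹) := by rw [hC]; simp only [Matrix.mul_assoc]
      _ = (upperProjection n p * K) * (D⁻¹ * (Cᵀ * diagonal ρ⁻¹)) := by
        rw [r₁, Matrix.mul_one, Matrix.mul_assoc _ V⁻¹ V, nonsing_inv_mul _ hV, Matrix.mul_one,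
          Matrix.mul_assoc]
      _ = 0 := by rw [upperProjection_mul_lowerInclusion, Matrix.zero_mul]
  · intro z hz _
    have hρz : ρ * z = diagonal ρ *ᵥ z := by ext j; simp [mulVec_diagonal]
    set u := V⁻¹ *ᵥ (ρ * z) with hu
    -- The kernel condition says that the first `p` entries of `u` vanish; hence `z` is `diagonal
    -- ρ⁻¹ * C` applied to `Kᵀ *ᵥ u`.
    have hu₁ : u = K *ᵥ (Kᵀ *ᵥ u) := by
      rw [← mulVec_mulVec, ← hu, upperProjection, sub_mulVec, one_mulVec, sub_eq_zero] at hz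
      rw [mulVec_mulVec]
      exact hz
    have hz₁ : z = (Kᵀ *ᵥ u) ᵥ* (Cᵀ * diagonal ρ⁻¹) := by
      have : z = diagonal ρ⁻¹ *ᵥ (V *ᵥ u) := by
        rw [hu, mulVec_mulVec _ V V⁻¹, mul_nonsing_inv _ hV, one_mulVec, hρz, mulVec_mulVec, r₂,
          one_mulVec]
      rw [← vecMul_vecMul, vecMul_transpose, hC, ← mulVec_mulVec, ← hu₁]
      conv_lhs => rw [this]
      ext j
      simp [mulVec_diagonal, vecMul_diagonal, mul_comm]
    conv_lhs => rw [hz₁]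
    rw [vecMul_vecMul, key, ← hz₁]

end Compression
end

/-! ### Regularity of the rescaled Hessian up to the boundary -/

noncomputable section

namespace DelzantPolytope.VertexChart

variable {n d p : ℕ} {P : DelzantPolytope n d} {c : P.VertexChart} {f g k : (Fin n → ℝ) → ℝ}
  {x : Fin n → ℝ}

theorem two_le_infty : (2 : WithTop ℕ∞) ≤ ∞ :=
  WithTop.coe_le_coe.2 le_top

theorem region_subset_closure_interior : c.region ⊆ closure (interior P.carrier) :=
  c.region_subset.trans P.carrier_subset_closure_interior

theorem nhdsWithin_interior_neBot (hx : x ∈ c.region) : (𝓝[interior P.carrier] x).NeBot :=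
  mem_closure_iff_nhdsWithin_neBot.1 (region_subset_closure_interior hx)

/-- The terms `l_r log l_r` of the facets not adjacent to `v` are smooth below `U_v`, since `l_r >
0` there; they are absorbed in the remainder. -/
theorem exists_hasSmoothRemainder (c : P.VertexChart) (hg : P.IsSymplecticPotential g) :
    ∃ k, c.HasSmoothRemainder g k := by
  obtain ⟨⟨h, hh, hgh⟩, -, -⟩ := hg
  set s : Finset (Fin d) := Finset.univ.image c.facetAt
  refine ⟨fun x => 1 / 2 * ∑ r ∈ sᶜ, P.l r x * Real.log (P.l r x) + h x, ?_, fun x hx => ?_⟩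
  · refine (contDiffOn_const.mul (.sum fun r hr => ?_)).add (hh.mono c.region_subset)
    refine (P.contDiff_l r).contDiffOn.mul ((P.contDiff_l r).contDiffOn.log fun x hx => ?_)
    refine (hx.2 r ?_).ne'
    simpa [s] using hr
  · rw [hgh x hx, guillemin, ← Finset.sum_add_sum_compl s,
      Finset.sum_image fun i _ j _ hij => c.injective hij]
    ring

theorem HasSmoothRemainder.potentialRay (h : c.HasSmoothRemainder g k)
    (B : SpecialLinearGroup (Fin n) ℤ) (p : ℕ) (s : ℝ) :
    c.HasSmoothRemainder (potentialRay B p g s) fun x => k x + s * hamiltonian B p x :=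
  ⟨h.contDiffOn.add (contDiffOn_const.mul (contDiff_hamiltonian B p).contDiffOn), fun x hx => by
    rw [_root_.potentialRay, h.eq_add x hx]; ring⟩

theorem isUnit_det_realMatrix (B : SpecialLinearGroup (Fin n) ℤ) : IsUnit (realMatrix B).det := by
  rw [det_realMatrix]; exact isUnit_one

theorem isUnit_det_Atilde (B : SpecialLinearGroup (Fin n) ℤ) : IsUnit (c.Atilde B).det := by
  have : c.Atilde B = c.A * (realMatrix B)⁻¹ := rfl
  rw [this, det_mul]
  exact c.isUnit_det_A.mul (isUnit_nonsing_inv_det _ (isUnit_det_realMatrix B))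

theorem Atilde_inv (B : SpecialLinearGroup (Fin n) ℤ) :
    (c.Atilde B)⁻¹ = realMatrix B * c.A⁻¹ := by
  have : c.Atilde B = c.A * (realMatrix B)⁻¹ := rfl
  rw [this, Matrix.mul_inv_rev, nonsing_inv_nonsing_inv _ (isUnit_det_realMatrix B)]

theorem invReal_eq (B : SpecialLinearGroup (Fin n) ℤ) : invReal B = c.A⁻¹ * c.Atilde B := by
  have : c.Atilde B = c.A * (realMatrix B)⁻¹ := rfl
  rw [this, ← Matrix.mul_assoc, nonsing_inv_mul _ c.isUnit_det_A, Matrix.one_mul]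
  rfl

/-- The differential of `(x̃_1, …, x̃_p)` in the vertex coordinates. -/
def conormal (c : P.VertexChart) (B : SpecialLinearGroup (Fin n) ℤ) (p : ℕ) :
    Matrix (Fin n) (Fin n) ℝ :=
  upperProjection n p * (c.Atilde B)⁻¹

theorem hessianIn_potentialRay (h : c.HasSmoothRemainder g k)
    (B : SpecialLinearGroup (Fin n) ℤ) (p : ℕ) (s : ℝ) (hx : x ∈ interior P.carrier) :
    hessianIn c.A⁻¹ (potentialRay B p g s) x =
      hessianIn c.A⁻¹ g x + s • ((c.conormal B p)ᵀ * c.conormal B p) := by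
  have h₁ := hessianIn_add_smul ((h.contDiffAt hx).of_le two_le_infty)
    ((contDiff_hamiltonian B p).contDiffAt.of_le two_le_infty) s c.A⁻¹
  refine h₁.trans ?_
  rw [hessianIn_hamiltonian, conormal, Atilde_inv, transpose_mul _ (realMatrix B * c.A⁻¹)]
  conv_lhs => rw [← upperProjection_transpose_mul_self]
  simp only [Matrix.mul_assoc]

theorem tendsto_smoothHessian (hk : ContDiffOn ℝ ∞ k c.region) (hx : x ∈ c.region) :
    Tendsto (c.smoothHessian k) (𝓝[interior P.carrier] x) (𝓝 (c.smoothHessian k x)) :=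
  (continuousOn_smoothHessian hk x hx).mono_left (nhdsWithin_mono _ c.interior_subset_region)

/-- In the interior the singular diagonal parts of both Hessians cancel; continuity gives the
boundary. -/
theorem smoothHessian_potentialRay (h : c.HasSmoothRemainder g k)
    (B : SpecialLinearGroup (Fin n) ℤ) (p : ℕ) (s : ℝ) (hx : x ∈ c.region) :
    c.smoothHessian (fun x => k x + s * hamiltonian B p x) x =
      c.smoothHessian k x + s • ((c.conormal B p)ᵀ * c.conormal B p) := by
  have := nhdsWithin_interior_neBot hx
  have h' := h.potentialRay B p s
  refine tendsto_nhds_unique (tendsto_smoothHessian h'.contDiffOn hx)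
    (((tendsto_smoothHessian h.contDiffOn hx).add_const _).congr' ?_)
  filter_upwards [self_mem_nhdsWithin] with y hy
  have h₁ := hessianIn_potentialRay h B p s hy
  rw [h.hessianIn_eq hy, h'.hessianIn_eq hy, add_assoc] at h₁
  exact (add_left_cancel h₁).symm

/-- The square roots `√(2 x_v^j) = |ξ_j|`. -/
def radii (c : P.VertexChart) (x : Fin n → ℝ) (j : Fin n) : ℝ := √(2 * P.l (c.facetAt j) x)

theorem radii_moment (ξ : Fin n → ℂ) : c.radii (c.moment ξ) = fun j => ‖ξ j‖ := by
  ext j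
  rw [radii, c.l_facetAt_moment, mul_div_cancel₀ _ two_ne_zero, Real.sqrt_sq (norm_nonneg _)]

theorem continuous_radii : Continuous c.radii :=
  continuous_pi fun _ => (continuous_const.mul (P.continuous_l _)).sqrt

theorem tendsto_radii (x : Fin n → ℝ) :
    Tendsto c.radii (𝓝[interior P.carrier] x) (𝓝 (c.radii x)) :=
  (continuous_radii.tendsto x).mono_left nhdsWithin_le_nhds

theorem radii_pos (hx : x ∈ interior P.carrier) (j : Fin n) : 0 < c.radii x j :=
  Real.sqrt_pos.2 (mul_pos two_pos (l_facetAt_pos hx j))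

theorem radii_mul_self (hx : x ∈ interior P.carrier) (j : Fin n) :
    c.radii x j * c.radii x j = 2 * P.l (c.facetAt j) x :=
  Real.mul_self_sqrt (mul_pos two_pos (l_facetAt_pos hx j)).le

/-- The rescaled Hessian of a potential with smooth remainder `k`. -/
def rescaledHessian (c : P.VertexChart) (k : (Fin n → ℝ) → ℝ) (x : Fin n → ℝ) :
    Matrix (Fin n) (Fin n) ℝ :=
  rescaled (c.radii x) (c.smoothHessian k x)

theorem tendsto_rescaledHessian (hk : ContDiffOn ℝ ∞ k c.region) (hx : x ∈ c.region) :
    Tendsto (c.rescaledHessian k) (𝓝[interior P.carrier] x) (𝓝 (c.rescaledHessian k x)) := by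
  have hdiag : Tendsto (fun y => diagonal (c.radii y)) (𝓝[interior P.carrier] x)
      (𝓝 (diagonal (c.radii x))) :=
    (continuous_id.matrix_diagonal.tendsto _).comp (tendsto_radii x)
  exact tendsto_const_nhds.add ((hdiag.mul (tendsto_smoothHessian hk hx)).mul hdiag)

theorem HasSmoothRemainder.rescaledHessian_eq (h : c.HasSmoothRemainder f k)
    (hx : x ∈ interior P.carrier) :
    c.rescaledHessian k x = diagonal (c.radii x) * hessianIn c.A⁻¹ f x * diagonal (c.radii x) := by
  rw [h.hessianIn_eq hx, rescaledHessian, rescaled, Matrix.mul_add, Matrix.add_mul,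
    diagonal_mul_diagonal, diagonal_mul_diagonal, ← diagonal_one]
  congr 2
  ext j
  have h₂ := (mul_pos two_pos (l_facetAt_pos (c := c) hx j)).ne'
  rw [mul_right_comm, radii_mul_self hx, mul_inv_cancel₀ h₂]

theorem inv_hessianIn_eq (h : c.HasSmoothRemainder f k) (hx : x ∈ interior P.carrier) :
    (hessianIn c.A⁻¹ f x)⁻¹ =
      diagonal (c.radii x) * (c.rescaledHessian k x)⁻¹ * diagonal (c.radii x) := by
  have hdet : IsUnit (diagonal (c.radii x)).det := by
    rw [det_diagonal, isUnit_iff_ne_zero]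
    exact Finset.prod_ne_zero_iff.2 fun j _ => (radii_pos hx j).ne'
  rw [h.rescaledHessian_eq hx, Matrix.mul_inv_rev, Matrix.mul_inv_rev, ← Matrix.mul_assoc, ← Matrix.mul_assoc,
    mul_nonsing_inv _ hdet, Matrix.one_mul, Matrix.mul_assoc, nonsing_inv_mul _ hdet,
    Matrix.mul_one]

theorem hessianIn_eq_transpose_mul_mul (h : c.HasSmoothRemainder f k)
    (hx : x ∈ interior P.carrier) :
    hessianIn c.A⁻¹ f x = c.A⁻¹ᵀ * hessianIn 1 f x * c.A⁻¹ := by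
  have := hessianIn_mul ((h.contDiffAt hx).of_le two_le_infty) 1 c.A⁻¹
  rwa [Matrix.one_mul] at this

theorem posDef_hessianIn (h : c.HasSmoothRemainder g k) (hg : P.IsSymplecticPotential g)
    (hx : x ∈ interior P.carrier) : (hessianIn c.A⁻¹ g x).PosDef := by
  rw [hessianIn_eq_transpose_mul_mul h hx]
  exact posDef_transpose_mul_mul (hg.2.1 x hx) (mul_nonsing_inv _ c.isUnit_det_A)

theorem posDef_rescaledHessian_interior (h : c.HasSmoothRemainder g k)
    (hg : P.IsSymplecticPotential g) (hx : x ∈ interior P.carrier) :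
    (c.rescaledHessian k x).PosDef := by
  rw [h.rescaledHessian_eq hx]
  have := posDef_transpose_mul_mul (posDef_hessianIn h hg hx)
    (diagonal_inv_mul_diagonal fun j => (radii_pos (c := c) hx j).ne')
  rwa [diagonal_transpose] at this

theorem posSemidef_of_tendsto {X : Type*} {l : Filter X} [l.NeBot]
    {M : X → Matrix (Fin n) (Fin n) ℝ} {M₀ : Matrix (Fin n) (Fin n) ℝ}
    (hM : Tendsto M l (𝓝 M₀)) (h : ∀ᶠ x in l, (M x).PosSemidef) : M₀.PosSemidef := by
  refine .of_dotProduct_mulVec_nonneg ?_ fun v => ?_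
  · have h₁ : Tendsto (fun x => (M x)ᴴ) l (𝓝 M₀ᴴ) :=
      (continuous_id.matrix_conjTranspose.tendsto M₀).comp hM
    exact tendsto_nhds_unique h₁ (hM.congr' (h.mono fun x hx => hx.1.symm))
  · have h₁ : Continuous fun M : Matrix (Fin n) (Fin n) ℝ => star v ⬝ᵥ M *ᵥ v := by fun_prop
    exact ge_of_tendsto ((h₁.tendsto M₀).comp hM) (h.mono fun x hx => hx.dotProduct_mulVec_nonneg v)

/-- In `det (R G R)` the factor `∏ 2 x_v^j` cancels the adjacent facets in `(δ ∏ l_r)⁻¹`. The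
resulting identity, in which only `δ` and the other `l_r` occur and whose right side is a positive
constant, passes to the boundary. -/
theorem det_rescaledHessian_ne_zero (h : c.HasSmoothRemainder g k)
    (hg : P.IsSymplecticPotential g) (hx : x ∈ c.region) : (c.rescaledHessian k x).det ≠ 0 := by
  have := nhdsWithin_interior_neBot hx
  obtain ⟨-, -, δ, hδ, hδpos, hdet⟩ := hg
  set s : Finset (Fin d) := Finset.univ.image c.facetAt
  have key : ∀ y ∈ interior P.carrier,
      (c.rescaledHessian k y).det * (δ y * ∏ r ∈ sᶜ, P.l r y) = 2 ^ n * c.A⁻¹.det ^ 2 := by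
    intro y hy
    have h₁ : (∏ j, c.radii y j) * (∏ j, c.radii y j) = 2 ^ n * ∏ r ∈ s, P.l r y := by
      rw [Finset.prod_image fun i _ j _ hij => c.injective hij, ← Finset.prod_mul_distrib]
      rw [Finset.prod_congr rfl fun j _ => radii_mul_self hy j]
      simp [Finset.prod_mul_distrib]
    have h₂ : ∏ r, P.l r y = (∏ r ∈ s, P.l r y) * ∏ r ∈ sᶜ, P.l r y :=
      (Finset.prod_mul_prod_compl s _).symm
    have h₃ := (hδpos y (interior_subset hy)).ne'
    have h₄ : ∀ t : Finset (Fin d), ∏ r ∈ t, P.l r y ≠ 0 := fun t =>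
      Finset.prod_ne_zero_iff.2 fun r _ => (P.mem_interior_carrier.1 hy r).ne'
    have h₅ := h₄ s
    have h₆ := h₄ sᶜ
    rw [h.rescaledHessian_eq hy, hessianIn_eq_transpose_mul_mul h hy]
    simp only [det_mul, det_diagonal, det_transpose]
    rw [hdet y hy, h₂]
    calc _ = ((∏ j, c.radii y j) * (∏ j, c.radii y j)) * c.A⁻¹.det ^ 2 *
          ((δ y * ((∏ r ∈ s, P.l r y) * ∏ r ∈ sᶜ, P.l r y))⁻¹ * (δ y * ∏ r ∈ sᶜ, P.l r y)) := by
          ring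
      _ = _ := by
          rw [h₁]
          field_simp
  have hlim : Tendsto (fun y => (c.rescaledHessian k y).det * (δ y * ∏ r ∈ sᶜ, P.l r y))
      (𝓝[interior P.carrier] x)
      (𝓝 ((c.rescaledHessian k x).det * (δ x * ∏ r ∈ sᶜ, P.l r x))) := by
    refine Tendsto.mul ?_ (.mul ?_ ?_)
    · exact ((continuous_id.matrix_det).tendsto _).comp (tendsto_rescaledHessian h.contDiffOn hx)
    · exact (hδ.continuousOn x hx.1).mono_left (nhdsWithin_mono _ interior_subset)
    · exact ((continuous_finsetProd _ fun r _ => P.continuous_l r).tendsto x).mono_left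
        nhdsWithin_le_nhds
  have hval := tendsto_nhds_unique hlim (tendsto_const_nhds.congr' (by
    filter_upwards [self_mem_nhdsWithin] with y hy using (key y hy).symm))
  intro h0
  rw [h0, zero_mul] at hval
  have h₁ : c.A⁻¹.det ≠ 0 := (isUnit_nonsing_inv_det _ c.isUnit_det_A).ne_zero
  have : (0 : ℝ) < 2 ^ n * c.A⁻¹.det ^ 2 := by positivity
  exact this.ne hval

/-- A limit of positive definite matrices is positive semidefinite, and definite as soon as it is
invertible. -/
theorem posDef_rescaledHessian (h : c.HasSmoothRemainder g k)
    (hg : P.IsSymplecticPotential g) (hx : x ∈ c.region) : (c.rescaledHessian k x).PosDef := by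
  have := nhdsWithin_interior_neBot hx
  have h₁ : (c.rescaledHessian k x).PosSemidef :=
    posSemidef_of_tendsto (tendsto_rescaledHessian h.contDiffOn hx) (by
      filter_upwards [self_mem_nhdsWithin] with y hy
      exact (posDef_rescaledHessian_interior h hg hy).posSemidef)
  exact h₁.posDef_iff_isUnit.2 ((Matrix.isUnit_iff_isUnit_det _).2
    (det_rescaledHessian_ne_zero h hg hx).isUnit)

theorem transpose_smoothHessian (h : c.HasSmoothRemainder g k)
    (hg : P.IsSymplecticPotential g) (hx : x ∈ c.region) :
    (c.smoothHessian k x)ᵀ = c.smoothHessian k x := by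
  have := nhdsWithin_interior_neBot hx
  have h₁ := tendsto_smoothHessian h.contDiffOn hx
  refine tendsto_nhds_unique ((continuous_id.matrix_transpose.tendsto _).comp h₁) (h₁.congr' ?_)
  filter_upwards [self_mem_nhdsWithin] with y hy
  have h₂ : (hessianIn c.A⁻¹ g y)ᵀ = hessianIn c.A⁻¹ g y :=
    (conjTranspose_eq_transpose_of_trivial _).symm.trans (posDef_hessianIn h hg hy).1
  rw [h.hessianIn_eq hy, transpose_add, diagonal_transpose] at h₂
  exact (add_left_cancel h₂).symm

end DelzantPolytope.VertexChart
end

/-! ### Boundary values, the limit of the inverse Hessians, and faces -/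

noncomputable section

namespace DelzantPolytope.VertexChart

variable {n d p : ℕ} {P : DelzantPolytope n d} {c : P.VertexChart} {f g k : (Fin n → ℝ) → ℝ}
  {x : Fin n → ℝ}

theorem tendsto_bdryValue {Y : Type*} [TopologicalSpace Y] {φ : (Fin n → ℝ) → Y} {y : Y}
    (h : Tendsto φ (𝓝[interior P.carrier] x) (𝓝 y)) :
    Tendsto φ (𝓝[interior P.carrier] x) (𝓝 (P.bdryValue φ x)) :=
  tendsto_extendFrom ⟨y, h⟩

theorem bdryValue_eq {Y : Type*} [TopologicalSpace Y] [T2Space Y] {φ : (Fin n → ℝ) → Y} {y : Y}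
    (hx : x ∈ c.region) (h : Tendsto φ (𝓝[interior P.carrier] x) (𝓝 y)) : P.bdryValue φ x = y :=
  extendFrom_eq (region_subset_closure_interior hx) h

theorem rescaledHessian_apply_eq_zero {j i : Fin n} (hj : c.radii x j ≠ 0) (hi : c.radii x i = 0) :
    c.rescaledHessian k x j i = 0 := by
  have hji : j ≠ i := fun h => hj (h ▸ hi)
  simp [rescaledHessian, rescaled, mul_diagonal, hi, hji]

theorem rescaledHessian_potentialRay (h : c.HasSmoothRemainder g k)
    (B : SpecialLinearGroup (Fin n) ℤ) (p : ℕ) (s : ℝ) (hx : x ∈ c.region) :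
    c.rescaledHessian (fun x => k x + s * hamiltonian B p x) x =
      c.rescaledHessian k x + s • (diagonal (c.radii x) *
        ((c.conormal B p)ᵀ * c.conormal B p) * diagonal (c.radii x)) := by
  simp only [rescaledHessian, rescaled, smoothHessian_potentialRay h B p s hx, Matrix.mul_add,
    Matrix.add_mul, Matrix.mul_smul, Matrix.smul_mul, add_assoc]

theorem posDef_rescaledHessian_potentialRay (h : c.HasSmoothRemainder g k)
    (hg : P.IsSymplecticPotential g)
    (B : SpecialLinearGroup (Fin n) ℤ) (p : ℕ) {s : ℝ} (hs : 0 ≤ s) (hx : x ∈ c.region) :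
    (c.rescaledHessian (fun x => k x + s * hamiltonian B p x) x).PosDef := by
  rw [rescaledHessian_potentialRay h B p s hx]
  refine (posDef_rescaledHessian h hg hx).add_posSemidef (.smul ?_ hs)
  have := posSemidef_conjTranspose_mul_self (c.conormal B p * diagonal (c.radii x))
  rw [conjTranspose_eq_transpose_of_trivial, transpose_mul, diagonal_transpose] at this
  simpa only [Matrix.mul_assoc] using this

/-- The inverse Hessian of the potential `g + s H` in the vertex coordinates, up to the boundary;
`k` is the smooth remainder of `g`. -/
def invHessian (c : P.VertexChart) (B : SpecialLinearGroup (Fin n) ℤ) (p : ℕ)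
    (k : (Fin n → ℝ) → ℝ) (s : ℝ) (x : Fin n → ℝ) : Matrix (Fin n) (Fin n) ℝ :=
  diagonal (c.radii x) * (c.rescaledHessian (fun x => k x + s * hamiltonian B p x) x)⁻¹ *
    diagonal (c.radii x)

theorem tendsto_diagonal_radii (x : Fin n → ℝ) :
    Tendsto (fun y => diagonal (c.radii y)) (𝓝[interior P.carrier] x)
      (𝓝 (diagonal (c.radii x))) :=
  (continuous_id.matrix_diagonal.tendsto _).comp (tendsto_radii x)

theorem tendsto_Gv_inv (h : c.HasSmoothRemainder g k) (hg : P.IsSymplecticPotential g)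
    (B : SpecialLinearGroup (Fin n) ℤ) (p : ℕ) {s : ℝ} (hs : 0 ≤ s) (hx : x ∈ c.region) :
    Tendsto (Gv_inv c B p g s) (𝓝[interior P.carrier] x) (𝓝 (c.invHessian B p k s x)) := by
  have h' := h.potentialRay B p s
  have hdet : IsUnit (c.rescaledHessian (fun x => k x + s * hamiltonian B p x) x).det :=
    (Matrix.isUnit_iff_isUnit_det _).1
      (posDef_rescaledHessian_potentialRay h hg B p hs hx).isUnit
  have hinv := (continuousAt_matrix_inv (c.rescaledHessian (fun x => k x + s * hamiltonian B p x) x)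
    (by simpa [Ring.inverse_eq_inv'] using continuousAt_inv₀ hdet.ne_zero)).tendsto.comp
      (tendsto_rescaledHessian h'.contDiffOn hx)
  refine (((tendsto_diagonal_radii x).mul hinv).mul (tendsto_diagonal_radii x)).congr' ?_
  filter_upwards [self_mem_nhdsWithin] with y hy
  exact (inv_hessianIn_eq h' hy).symm

theorem Gtilde_inv_eq (h : c.HasSmoothRemainder g k)
    (B : SpecialLinearGroup (Fin n) ℤ) (p : ℕ) (s : ℝ) (hx : x ∈ interior P.carrier) :
    Gtilde_inv B p g s x =
      (c.Atilde B)⁻¹ * Gv_inv c B p g s x * (c.Atilde B)⁻¹ᵀ := by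
  rw [Gtilde_inv, Gv_inv, invReal_eq (c := c) B,
    hessianIn_mul (((h.potentialRay B p s).contDiffAt hx).of_le two_le_infty),
    Matrix.mul_inv_rev, Matrix.mul_inv_rev, transpose_nonsing_inv, Matrix.mul_assoc]

theorem tendsto_Gtilde_inv (h : c.HasSmoothRemainder g k) (hg : P.IsSymplecticPotential g)
    (B : SpecialLinearGroup (Fin n) ℤ) (p : ℕ) {s : ℝ} (hs : 0 ≤ s) (hx : x ∈ c.region) :
    Tendsto (Gtilde_inv B p g s) (𝓝[interior P.carrier] x)
      (𝓝 ((c.Atilde B)⁻¹ * c.invHessian B p k s x * (c.Atilde B)⁻¹ᵀ)) := by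
  refine ((tendsto_const_nhds.mul (tendsto_Gv_inv h hg B p hs hx)).mul
    tendsto_const_nhds).congr' ?_
  filter_upwards [self_mem_nhdsWithin] with y hy
  exact (Gtilde_inv_eq h B p s hy).symm

/-- The boundary value of `D⁻¹`, and the limit of the inverse Hessians of `g + s H`. -/
theorem exists_tendsto_D_inv (h : c.HasSmoothRemainder g k) (hg : P.IsSymplecticPotential g)
    (B : SpecialLinearGroup (Fin n) ℤ) (p : ℕ) (hx : x ∈ c.region) :
    ∃ E, Tendsto (D_inv B p g) (𝓝[interior P.carrier] x) (𝓝 E) ∧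
      Tendsto (fun s => c.invHessian B p k s x) atTop
        (𝓝 (c.Atilde B * diagZero p E * (c.Atilde B)ᵀ)) ∧
      ∀ i j, c.radii x i = 0 → (c.Atilde B * diagZero p E * (c.Atilde B)ᵀ) j i = 0 := by
  have := nhdsWithin_interior_neBot hx
  have hV := isUnit_det_Atilde (c := c) B
  set V := c.Atilde B
  have hD : ∀ y ∈ interior P.carrier,
      D_inv B p g y = (lowerBlock p (Vᵀ * hessianIn c.A⁻¹ g y * V))⁻¹ := fun y hy => by
    rw [D_inv, invReal_eq (c := c) B, hessianIn_mul ((h.contDiffAt hy).of_le two_le_infty)]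
  -- Chosen so that `R Θ R = V diag(0, D⁻¹) Vᵀ` with `R = diagonal (c.radii y)`, the form in which
  -- the compression lemmas apply.
  set Θ : (Fin n → ℝ) → Matrix (Fin n) (Fin n) ℝ := fun y =>
    diagonal (c.radii y)⁻¹ * (V * diagZero p (D_inv B p g y) * Vᵀ) * diagonal (c.radii y)⁻¹ with hΘ
  have hchar : ∀ y ∈ interior P.carrier, (Θ y)ᵀ = Θ y ∧
      Θ y * c.rescaledHessian k y * Θ y = Θ y ∧
      IsCompressedInverse (c.radii y) (c.rescaledHessian k y) (c.conormal B p) (Θ y) := by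
    intro y hy
    rw [h.rescaledHessian_eq hy]
    exact isCompressedInverse_of_posDef (posDef_hessianIn h hg hy) hV
      (fun j => (radii_pos hy j).ne') (by rw [hΘ, ← hD y hy])
  have hmem : ∀ᶠ y in 𝓝[interior P.carrier] x, y ∈ interior P.carrier := self_mem_nhdsWithin
  have hQ₀ := posDef_rescaledHessian h hg hx
  have hblock : ∀ j i, c.radii x j ≠ 0 → c.radii x i = 0 → c.rescaledHessian k x j i = 0 :=
    fun j i => rescaledHessian_apply_eq_zero
  obtain ⟨Θ₀, hΘ₀, hlim⟩ := exists_tendsto_compressedInverse (Θ := Θ) hQ₀ hblock (tendsto_radii x)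
    (tendsto_rescaledHessian h.contDiffOn hx)
    (hmem.mono fun y hy => posDef_rescaledHessian_interior h hg hy)
    (hmem.mono fun y hy => (hchar y hy).1)
    (hmem.mono fun y hy => by rw [(hchar y hy).2.1, sub_self]; exact .zero)
    (hmem.mono fun y hy => (hchar y hy).2.2)
  set L₀ := diagonal (c.radii x) * Θ₀ * diagonal (c.radii x) with hL₀
  have hlim' : Tendsto (fun y => V * diagZero p (D_inv B p g y) * Vᵀ) (𝓝[interior P.carrier] x)
      (𝓝 L₀) := by
    refine hlim.congr' (hmem.mono fun y hy => ?_)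
    have hne : ∀ j, c.radii y j ≠ 0 := fun j => (radii_pos hy j).ne'
    rw [hΘ]
    simp only [← Matrix.mul_assoc]
    rw [diagonal_mul_diagonal_inv hne, Matrix.one_mul, Matrix.mul_assoc _ (diagonal _) (diagonal _),
      diagonal_inv_mul_diagonal hne, Matrix.mul_one]
  set K := lowerInclusion n p
  have hKK : Kᵀ * K = 1 := lowerInclusion_transpose_mul_self n p
  have hVt : IsUnit Vᵀ.det := by rwa [det_transpose]
  -- `E` is a continuous function of `V diag(0, E) Vᵀ`, so convergence of the latter gives
  -- convergence of `D⁻¹`.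
  have hrecover : ∀ E, Kᵀ * V⁻¹ * (V * diagZero p E * Vᵀ) * (Vᵀ)⁻¹ * K = E := fun E => by
    calc Kᵀ * V⁻¹ * (V * diagZero p E * Vᵀ) * (Vᵀ)⁻¹ * K
        = Kᵀ * (V⁻¹ * V) * diagZero p E * (Vᵀ * (Vᵀ)⁻¹) * K := by simp only [Matrix.mul_assoc]
      _ = (Kᵀ * K) * E * (Kᵀ * K) := by
        rw [nonsing_inv_mul _ hV, mul_nonsing_inv _ hVt, Matrix.mul_one, Matrix.mul_one,
          diagZero_eq]
        simp only [Matrix.mul_assoc]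
        rfl
      _ = E := by rw [hKK, Matrix.one_mul, Matrix.mul_one]
  set E₀ := Kᵀ * V⁻¹ * L₀ * (Vᵀ)⁻¹ * K
  have hE : Tendsto (D_inv B p g) (𝓝[interior P.carrier] x) (𝓝 E₀) := by
    have hc : Continuous fun M : Matrix (Fin n) (Fin n) ℝ => Kᵀ * V⁻¹ * M * (Vᵀ)⁻¹ * K := by
      fun_prop
    refine ((hc.tendsto L₀).comp hlim').congr fun y => ?_
    exact hrecover _
  have hL : V * diagZero p E₀ * Vᵀ = L₀ := by
    refine tendsto_nhds_unique ?_ hlim'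
    have hc : Continuous fun E => V * diagZero p E * Vᵀ := by
      simp only [diagZero_eq]
      fun_prop
    exact (hc.tendsto E₀).comp hE
  refine ⟨E₀, hE, ?_, ?_⟩
  · rw [hL]
    -- The same `Θ₀` that describes the boundary value of `D⁻¹` describes the limit in `s`.
    refine (hΘ₀.tendsto_inv_add_smul hQ₀ hblock).congr fun s => ?_
    rw [invHessian, rescaledHessian_potentialRay h B p s hx]
  · intro i j hi
    rw [hL, hL₀, mul_diagonal, hi, mul_zero]

theorem invHessian_apply_eq_zero (B : SpecialLinearGroup (Fin n) ℤ) (p : ℕ) (s : ℝ) {i : Fin n}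
    (hi : c.radii x i = 0) (j : Fin n) : c.invHessian B p k s x j i = 0 := by
  rw [invHessian, mul_diagonal, hi, mul_zero]

/-- This is `Q⁻¹ (1 + R S R) = 1` between two factors `R`, hence valid also where `R` is singular;
it is the hypothesis `hMS` of `kahlerPolarization_eq_span`. -/
theorem invHessian_add_mul (h : c.HasSmoothRemainder g k) (hg : P.IsSymplecticPotential g)
    (B : SpecialLinearGroup (Fin n) ℤ) (p : ℕ) {s : ℝ} (hs : 0 ≤ s) (hx : x ∈ c.region) :
    c.invHessian B p k s x + c.invHessian B p k s x *
      c.smoothHessian (fun x => k x + s * hamiltonian B p x) x *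
        diagonal (fun j => c.radii x j ^ 2) = diagonal (fun j => c.radii x j ^ 2) := by
  have hdet : IsUnit (c.rescaledHessian (fun x => k x + s * hamiltonian B p x) x).det :=
    (Matrix.isUnit_iff_isUnit_det _).1
      (posDef_rescaledHessian_potentialRay h hg B p hs hx).isUnit
  have hsq : diagonal (fun j => c.radii x j ^ 2) = diagonal (c.radii x) * diagonal (c.radii x) := by
    rw [diagonal_mul_diagonal]
    simp only [pow_two]
  rw [hsq, invHessian]
  set S := c.smoothHessian (fun x => k x + s * hamiltonian B p x) x with hS
  set Q := c.rescaledHessian (fun x => k x + s * hamiltonian B p x) x with hQ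
  have hQS : Q = 1 + diagonal (c.radii x) * S * diagonal (c.radii x) := rfl
  calc diagonal (c.radii x) * Q⁻¹ * diagonal (c.radii x) + diagonal (c.radii x) * Q⁻¹ *
        diagonal (c.radii x) * S * (diagonal (c.radii x) * diagonal (c.radii x))
      = diagonal (c.radii x) * (Q⁻¹ * (1 + diagonal (c.radii x) * S * diagonal (c.radii x))) *
          diagonal (c.radii x) := by noncomm_ring
    _ = diagonal (c.radii x) * diagonal (c.radii x) := by
      rw [← hQS, nonsing_inv_mul _ hdet, Matrix.mul_one]

/-- The segment from `z` to `x` can be prolonged a little beyond `x` inside `F`. An affine function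
that vanishes at `x` and is nonnegative on both sides vanishes at `z`. -/
theorem l_eq_zero_of_mem_intrinsicInterior {F : Set (Fin n → ℝ)} (hF : F ⊆ P.carrier) {r : Fin d}
    (hx : x ∈ intrinsicInterior ℝ F) (hr : P.l r x = 0) {z : Fin n → ℝ} (hz : z ∈ F) :
    P.l r z = 0 := by
  rw [mem_intrinsicInterior] at hx
  obtain ⟨y, hy, rfl⟩ := hx
  refine le_antisymm ?_ (hF hz r)
  have hzmem : z ∈ affineSpan ℝ F := subset_affineSpan ℝ F hz
  let γ : ℝ → affineSpan ℝ F := fun t =>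
    ⟨AffineMap.lineMap (y : Fin n → ℝ) z t, AffineMap.lineMap_mem t y.2 hzmem⟩
  have hγ : Continuous γ := by
    refine Continuous.subtype_mk ?_ _
    exact AffineMap.lineMap_continuous
  have hγ0 : γ 0 = y := Subtype.ext (AffineMap.lineMap_apply_zero _ _)
  have hev : ∀ᶠ t in 𝓝[<] (0 : ℝ), ((γ t : affineSpan ℝ F) : Fin n → ℝ) ∈ F := by
    have : Tendsto γ (𝓝[<] 0) (𝓝 y) := by
      have := hγ.tendsto 0
      rw [hγ0] at this
      exact this.mono_left nhdsWithin_le_nhds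
    exact this (mem_interior_iff_mem_nhds.1 hy)
  obtain ⟨t, ht, ht0⟩ := (hev.and (self_mem_nhdsWithin (s := Set.Iio (0 : ℝ)))).exists
  have h₁ := hF ht r
  have h₂ : ((γ t : affineSpan ℝ F) : Fin n → ℝ) = (1 - t) • (y : Fin n → ℝ) + t • z :=
    AffineMap.lineMap_apply_module _ _ _
  rw [h₂, P.l_combo r (by ring), hr, mul_zero, zero_add] at h₁
  have ht0 : t < 0 := ht0
  by_contra! hpos
  nlinarith

/-- Since `w_v^j` and `ξ_j` have the same zeros, what must be shown is that a facet through one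
relative interior point of `F` contains all of `F`. -/
theorem mem_faceIndices_iff (h : c.HasSmoothRemainder g k) {F : Set (Fin n → ℝ)}
    (hF : F ⊆ P.carrier) {ξ : Fin n → ℂ} (hξ : ξ ∈ c.U)
    (hξF : c.moment ξ ∈ intrinsicInterior ℝ F) (j : Fin n) :
    j ∈ c.faceIndices g F ↔ ξ j = 0 := by
  have hw : ∀ η ∈ c.U, c.w g j η = 0 ↔ η j = 0 := fun η hη => by
    rw [h.w_eq hη, mul_eq_zero, Complex.ofReal_eq_zero, or_iff_right (scale_pos j η).ne']
  simp only [faceIndices, Finset.mem_filter, Finset.mem_univ, true_and]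
  constructor
  · intro hj
    exact (hw ξ hξ).1 (hj ξ hξ (intrinsicInterior_subset hξF))
  · intro hj η hη hηF
    rw [hw η hη]
    have h₁ : P.l (c.facetAt j) (c.moment ξ) = 0 := by rw [c.l_facetAt_moment, hj]; simp
    have h₂ := l_eq_zero_of_mem_intrinsicInterior hF hξF h₁ hηF
    rw [c.l_facetAt_moment] at h₂
    simpa using h₂

end DelzantPolytope.VertexChart
end

/-! ### The limit polarization -/

noncomputable section
namespace DelzantPolytope.VertexChart

variable {n d p : ℕ} {P : DelzantPolytope n d} {c : P.VertexChart} {g k : (Fin n → ℝ) → ℝ}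

/-- The vectors `W j`, `j ∈ I`, are fixed while `s` varies, so the frames depend on `s` only through
the inverse Hessian, and continuously. -/
theorem tendstoGrassmannian_kahlerPolarization (h : c.HasSmoothRemainder g k)
    (hg : P.IsSymplecticPotential g) (B : SpecialLinearGroup (Fin n) ℤ) {ξ : Fin n → ℂ}
    (hξ : ξ ∈ c.U) {I : Finset (Fin n)} (hI : ∀ i, i ∈ I ↔ ξ i = 0) {W : Fin n → TangentC n}
    (hW : ∀ j ∈ I, ∃ a : ℂ, a ≠ 0 ∧ W j = a • holoVector j) :
    (∀ s : ℝ, 0 ≤ s → c.kahlerPolarization (potentialRay B p g s) ξ =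
      Submodule.span ℂ (Set.range (c.frame ξ I W (c.invHessian B p k s (c.moment ξ))))) ∧
    ∀ M, Tendsto (fun s => c.invHessian B p k s (c.moment ξ)) atTop (𝓝 M) →
      TendstoGrassmannian n (fun s => c.kahlerPolarization (potentialRay B p g s) ξ)
        (Submodule.span ℂ (Set.range (c.frame ξ I W M))) := by
  have hx := c.moment_mem_region hξ
  have hrad := c.radii_moment ξ
  have hpol : ∀ s : ℝ, 0 ≤ s → c.kahlerPolarization (potentialRay B p g s) ξ =
      Submodule.span ℂ (Set.range (c.frame ξ I W (c.invHessian B p k s (c.moment ξ)))) := by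
    intro s hs
    refine (h.potentialRay B p s).kahlerPolarization_eq_span hξ hI ?_ hW ?_ ?_ ?_
    · have := (posDef_rescaledHessian_potentialRay h hg B p hs hx).isUnit
      rw [Matrix.isUnit_iff_isUnit_det, rescaledHessian, hrad] at this
      exact this.ne_zero
    · intro i hi j
      exact invHessian_apply_eq_zero B p s (by simp [hrad, (hI i).1 hi]) j
    · rw [smoothHessian_potentialRay h B p s hx, transpose_add, transpose_smul, transpose_mul,
        transpose_transpose, transpose_smoothHessian h hg hx]
    · have := invHessian_add_mul h hg B p hs hx
      rwa [hrad] at this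
  refine ⟨hpol, fun M hM => ⟨fun s => c.frame ξ I W (c.invHessian B p k s (c.moment ξ)),
    c.frame ξ I W M, ?_, linearIndependent_frame hI hW M, rfl, ?_⟩⟩
  · filter_upwards [eventually_ge_atTop 0] with s hs
    exact ⟨linearIndependent_frame hI hW _, (hpol s hs).symm⟩
  · exact ((continuous_frame W).tendsto M).comp hM

theorem exists_isHolomorphicFrame_potentialRay (h : c.HasSmoothRemainder g k)
    (hg : P.IsSymplecticPotential g) (B : SpecialLinearGroup (Fin n) ℤ) {ξ : Fin n → ℂ}
    (hξ : ξ ∈ c.U) {t : ℝ} (ht : 0 ≤ t) :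
    ∃ W, c.IsHolomorphicFrame (potentialRay B p g t) ξ W ∧
      ∀ j, ξ j = 0 → ∃ a : ℂ, a ≠ 0 ∧ W j = a • holoVector j := by
  have hdet := (posDef_rescaledHessian_potentialRay h hg B p ht (c.moment_mem_region hξ)).isUnit
  rw [Matrix.isUnit_iff_isUnit_det, rescaledHessian, c.radii_moment ξ] at hdet
  obtain ⟨W, hW⟩ := (h.potentialRay B p t).exists_isHolomorphicFrame hξ hdet.ne_zero
  exact ⟨W, hW, fun j hj => (h.potentialRay B p t).eq_smul_holoVector hξ hdet.ne_zero hW hj⟩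

end DelzantPolytope.VertexChart
end
theorem proposition3p2 {n d p : ℕ} (hp : p < n) (P : DelzantPolytope n d)
    (g : (Fin n → ℝ) → ℝ) (hg : P.IsSymplecticPotential g)
    (B : Matrix.SpecialLinearGroup (Fin n) ℤ) (c : P.VertexChart)
    (F : Set (Fin n → ℝ)) (hF : IsExposed ℝ P.carrier F)
    (ξ : Fin n → ℂ) (hξU : ξ ∈ c.U) (hξF : c.moment ξ ∈ intrinsicInterior ℝ F) :
    -- the inverse matrices extend continuously to the boundary point below `ξ`
    (∀ s : ℝ, 0 ≤ s →
      (Tendsto (Gtilde_inv B p g s) (𝓝[interior P.carrier] (c.moment ξ))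
        (𝓝 (P.bdryValue (Gtilde_inv B p g s) (c.moment ξ)))) ∧
      (Tendsto (Gv_inv c B p g s) (𝓝[interior P.carrier] (c.moment ξ))
        (𝓝 (P.bdryValue (Gv_inv c B p g s) (c.moment ξ))))) ∧
    (Tendsto (D_inv B p g) (𝓝[interior P.carrier] (c.moment ξ))
      (𝓝 (P.bdryValue (D_inv B p g) (c.moment ξ)))) ∧
    -- the limit of the inverse Hessians is `diag(0, D⁻¹)`
    Tendsto (fun s => P.bdryValue (Gtilde_inv B p g s) (c.moment ξ)) atTop
      (𝓝 (diagZero p (P.bdryValue (D_inv B p g) (c.moment ξ)))) ∧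
    -- the combinations of the `∂/∂x_v^k` that occur are tangent to the face
    (∀ k ∈ c.faceIndices g F, ∀ j,
      (∀ s : ℝ, 0 ≤ s → P.bdryValue (Gv_inv c B p g s) (c.moment ξ) j k = 0) ∧
      (c.Atilde B * diagZero p (P.bdryValue (D_inv B p g) (c.moment ξ)) *
        (c.Atilde B)ᵀ) j k = 0) ∧
    -- the vectors `∂/∂w_v^j`, for the holomorphic coordinates of any of the potentials `g_t`
    (∀ t : ℝ, 0 ≤ t → ∃ W : Fin n → TangentC n,
      c.IsHolomorphicFrame (potentialRay B p g t) ξ W ∧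
      -- the Kähler polarizations along the face
      (∀ s : ℝ, 0 ≤ s →
        c.kahlerPolarization (potentialRay B p g s) ξ =
          Submodule.span ℂ (W '' {j | j ∈ c.faceIndices g F}) ⊔
          Submodule.span ℂ (c.mixedVector ξ (c.faceIndices g F)
            (P.bdryValue (Gv_inv c B p g s) (c.moment ξ)) '' {j | j ∉ c.faceIndices g F}) ∧
        Disjoint (Submodule.span ℂ (W '' {j | j ∈ c.faceIndices g F}))
          (Submodule.span ℂ (c.mixedVector ξ (c.faceIndices g F)
            (P.bdryValue (Gv_inv c B p g s) (c.moment ξ)) '' {j | j ∉ c.faceIndices g F}))) ∧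
      -- their limit, in terms of the limit of the inverse Hessians
      TendstoGrassmannian n (fun s => c.kahlerPolarization (potentialRay B p g s) ξ)
        (Submodule.span ℂ (W '' {j | j ∈ c.faceIndices g F}) ⊔
          Submodule.span ℂ (c.mixedVector ξ (c.faceIndices g F)
            (c.Atilde B * diagZero p (P.bdryValue (D_inv B p g) (c.moment ξ)) *
              (c.Atilde B)ᵀ) '' {j | j ∉ c.faceIndices g F})) ∧
      -- their limit, in terms of `D⁻¹`
      TendstoGrassmannian n (fun s => c.kahlerPolarization (potentialRay B p g s) ξ)
        (Submodule.span ℂ (W '' {j | j ∈ c.faceIndices g F}) ⊔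
          Submodule.span ℂ (limitVector c B p ξ (c.faceIndices g F)
            (P.bdryValue (D_inv B p g) (c.moment ξ)) '' {j | j ∉ c.faceIndices g F})) ∧
      Disjoint (Submodule.span ℂ (W '' {j | j ∈ c.faceIndices g F}))
        (Submodule.span ℂ (limitVector c B p ξ (c.faceIndices g F)
          (P.bdryValue (D_inv B p g) (c.moment ξ)) '' {j | j ∉ c.faceIndices g F}))) := by
  obtain ⟨k, hk⟩ := DelzantPolytope.VertexChart.exists_hasSmoothRemainder c hg
  have hx := c.moment_mem_region hξU
  have hFP : F ⊆ P.carrier := by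
    -- Exposedness provides a functional only for a nonempty set; the point below `ξ` shows that `F`
    -- is nonempty.
    obtain ⟨l, hl⟩ := hF ⟨_, intrinsicInterior_subset hξF⟩
    rw [hl]
    exact fun y hy => hy.1
  have hI := DelzantPolytope.VertexChart.mem_faceIndices_iff hk hFP hξU hξF
  set I := c.faceIndices g F
  obtain ⟨E, hE, hlim, hzero⟩ :=
    DelzantPolytope.VertexChart.exists_tendsto_D_inv hk hg B p hx
  have hbE : P.bdryValue (D_inv B p g) (c.moment ξ) = E :=
    DelzantPolytope.VertexChart.bdryValue_eq hx hE
  have hGv := fun (s : ℝ) (hs : 0 ≤ s) =>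
    DelzantPolytope.VertexChart.tendsto_Gv_inv hk hg B p hs hx
  have hGt := fun (s : ℝ) (hs : 0 ≤ s) =>
    DelzantPolytope.VertexChart.tendsto_Gtilde_inv hk hg B p hs hx
  have hbv := fun (s : ℝ) (hs : 0 ≤ s) =>
    DelzantPolytope.VertexChart.bdryValue_eq hx (hGv s hs)
  have hbt := fun (s : ℝ) (hs : 0 ≤ s) =>
    DelzantPolytope.VertexChart.bdryValue_eq hx (hGt s hs)
  have hrad : ∀ i ∈ I, c.radii (c.moment ξ) i = 0 := fun i hi => by
    simp [c.radii_moment ξ, (hI i).1 hi]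
  refine ⟨fun s hs => ⟨DelzantPolytope.VertexChart.tendsto_bdryValue (hGt s hs),
    DelzantPolytope.VertexChart.tendsto_bdryValue (hGv s hs)⟩,
    DelzantPolytope.VertexChart.tendsto_bdryValue hE, ?_, fun i hi j => ⟨fun s hs => ?_, ?_⟩,
    fun t ht => ?_⟩
  · rw [hbE]
    have hV := DelzantPolytope.VertexChart.isUnit_det_Atilde (c := c) B
    have hVt : IsUnit (c.Atilde B)ᵀ.det := by rwa [det_transpose]
    -- The limit is known in vertex coordinates; conjugation by `(c.Atilde B)⁻¹` takes it back to
    -- the coordinates `x̃`.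
    have h₁ := (tendsto_const_nhds (x := (c.Atilde B)⁻¹)).mul hlim |>.mul
      (tendsto_const_nhds (x := (c.Atilde B)⁻¹ᵀ))
    have h₂ : (c.Atilde B)⁻¹ * (c.Atilde B * diagZero p E * (c.Atilde B)ᵀ) * (c.Atilde B)⁻¹ᵀ =
        diagZero p E := by
      rw [transpose_nonsing_inv, Matrix.mul_assoc (c.Atilde B), nonsing_inv_mul_cancel_left _ _ hV,
        mul_nonsing_inv_cancel_right _ _ hVt]
    rw [h₂] at h₁
    refine h₁.congr' ?_
    filter_upwards [eventually_ge_atTop 0] with s hs using (hbt s hs).symm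
  · rw [hbv s hs]
    exact DelzantPolytope.VertexChart.invHessian_apply_eq_zero B p s (hrad i hi) j
  · rw [hbE]
    exact hzero i j (hrad i hi)
  · obtain ⟨W, hWf, hW⟩ :=
      DelzantPolytope.VertexChart.exists_isHolomorphicFrame_potentialRay hk hg B hξU ht (p := p)
    have hWI : ∀ j ∈ I, ∃ a : ℂ, a ≠ 0 ∧ W j = a • DelzantPolytope.VertexChart.holoVector j :=
      fun j hj => hW j ((hI j).1 hj)
    obtain ⟨hpol, hgrass⟩ :=
      DelzantPolytope.VertexChart.tendstoGrassmannian_kahlerPolarization (p := p) hk hg B hξU hI hWI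
    have hT := hgrass _ hlim
    rw [DelzantPolytope.VertexChart.span_range_frame] at hT
    have hvec : limitVector c B p ξ I E =
        c.mixedVector ξ I (c.Atilde B * diagZero p E * (c.Atilde B)ᵀ) :=
      funext fun j => DelzantPolytope.VertexChart.limitVector_eq_mixedVector B p E j
    refine ⟨W, hWf, fun s hs => ⟨?_, ?_⟩, ?_, ?_, ?_⟩
    · rw [hpol s hs, DelzantPolytope.VertexChart.span_range_frame, hbv s hs]
    · exact DelzantPolytope.VertexChart.disjoint_span_frame hI hWI _
    · rwa [hbE]
    · rwa [hbE, hvec]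
    · rw [hbE, hvec]
      exact DelzantPolytope.VertexChart.disjoint_span_frame hI hWI _
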